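/- **Theorem (Sunada gap labeling).** Let $\mathcal G$ be a finite connected undirected graph with $p$ vertices, in which self-loops and parallel edges are allowed and every vertex has degree at least $2$ (a self-loop counts twice in the degree). Let real numbers $B_v$ at the vertices $v$ and strictly positive numbers $A_e$ at the edges $e$ of $\mathcal G$ be given. Let $\Xi:\mathcal T\to\mathcal G$ be the universal cover of $\mathcal G$, that is, a tree $\mathcal T$ with a covering map $\Xi$ taking vertices to vertices and edges to edges. Let $H$ be the periodic Jacobi matrix of period $p$ obtained by lifting these parameters to $\mathcal T$: the bounded self-adjoint operator on $\ell^2$ of the vertex set of $\mathcal T$ with matrix elements $H_{xx}=B_{\Xi(x)}$, $H_{xy}=A_{\Xi(\alpha)}$ if $x\neq y$ are the two ends of an edge $\alpha$ of $\mathcal T$, and $H_{xy}=0$ otherwise. For a vertex $x$ of $\mathcal T$ let $\mu_x$ be the spectral measure of $H$ at $\delta_x$, so that $\langle\delta_x,f(H)\delta_x\rangle=\int f\,d\mu_x$. Choose for each vertex $v$ of $\mathcal G$ a vertex $r_v$ of $\mathcal T$ with $\Xi(r_v)=v$, and define the density of states and the integrated density of states by $$dk=\frac1p\sum_{v\in\mathcal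 G}d\mu_{r_v},\qquad k(\lambda)=\int_{(-\infty,\lambda)}dk .$$ Then, for every such choice: 1. For every gap $(\alpha,\beta)$ of the spectrum of $H$ (that is, every bounded connected component of $\mathbb R\setminus\operatorname{spec}(H)$) there is $j\in\{1,\dots,p-1\}$ with $k(\lambda)=j/p$ for all $\lambda\in(\alpha,\beta)$. 2. In particular, $\operatorname{spec}(H)$ is a union of at most $p$ closed intervals $[c_i,d_i]$, $c_i\le d_i$ (an interval may be a single point). -/

import Mathlib

noncomputable section

/-- An undirected multigraph with vertex set `V` and edge set `E`; parallel edges and self-loops are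
allowed. The two ends of an edge are listed in an arbitrary order; this order only serves to tell
the two directions of an edge apart. -/
structure Multigraph (V E : Type*) where
  ends : E → V × V

namespace Multigraph

variable {V E : Type*}

/-- A directed edge: an edge with one of its two directions. A self-loop also has two. -/
abbrev Dart (_G : Multigraph V E) : Type _ := E × Bool

/-- The initial vertex of a directed edge. -/
def source (G : Multigraph V E) (d : G.Dart) : V :=
  if d.2 then (G.ends d.1).1 else (G.ends d.1).2

/-- The same edge, traversed in the opposite direction. -/
def reverse (G : Multigraph V E) (d : G.Dart) : G.Dart := (d.1, !d.2)

/-- The final vertex of a directed edge. -/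
def target (G : Multigraph V E) (d : G.Dart) : V := G.source (G.reverse d)

/-- The degree of a vertex: the number of edges of which it is an end, where a self-loop counts
twice. -/
def degree (G : Multigraph V E) (v : V) : ℕ := Nat.card {d : G.Dart // G.source d = v}

/-- Any vertex is joined to any other by a path. -/
def Connected (G : Multigraph V E) : Prop :=
  Nonempty V ∧
    ∀ u v : V, Relation.ReflTransGen (fun x y => ∃ d : G.Dart, G.source d = x ∧ G.target d = y) u v

end Multigraph

/-- A covering map from a simple graph `T` to a multigraph `G`: it takes vertices to vertices and
directed edges to directed edges, respects ends and reversal of direction, and maps the directed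
edges issuing from a vertex `x` bijectively onto those issuing from the image of `x`. A tree has
neither self-loops nor parallel edges, so if `T` is a tree, this is the universal cover of the
connected multigraph `G`. -/
structure GraphCovering {V E W : Type*} (T : SimpleGraph W) (G : Multigraph V E) where
  onVert : W → V
  onDart : T.Dart → G.Dart
  source_onDart : ∀ d : T.Dart, G.source (onDart d) = onVert d.fst
  onDart_symm : ∀ d : T.Dart, onDart d.symm = G.reverse (onDart d)
  bijOn_star : ∀ x : W,
    Set.BijOn onDart {d : T.Dart | d.fst = x} {e : G.Dart | G.source e = onVert x}

/-- The Hilbert space `ℓ²(W)` of square-summable complex functions on the vertices. -/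
abbrev VertexSpace (W : Type*) : Type _ := lp (fun _ : W => ℂ) 2

namespace GraphCovering

variable {V E W : Type*} {T : SimpleGraph W} {G : Multigraph V E}

open Classical in
/-- The matrix elements of the lift to `T` of the Jacobi matrix on `G` with parameters `b`, `a`:
the parameter at a vertex or edge of `T` is that of its image in `G`. -/
def entry (Ξ : GraphCovering T G) (b : V → ℝ) (a : E → ℝ) (x y : W) : ℝ :=
  if x = y then b (Ξ.onVert x)
  else if h : T.Adj x y then a (Ξ.onDart ⟨(x, y), h⟩).1
  else 0

open Classical in
/-- A vertex together with its neighbours: the only columns in which row `x` can be non-zero. -/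
def closedNbhd (T : SimpleGraph W) [T.LocallyFinite] (x : W) : Finset W :=
  insert x (T.neighborFinset x)

theorem mem_closedNbhd [T.LocallyFinite] {x y : W} : y ∈ closedNbhd T x ↔ y = x ∨ T.Adj x y := by
  simp [closedNbhd]

theorem mem_closedNbhd_comm [T.LocallyFinite] {x y : W} :
    y ∈ closedNbhd T x ↔ x ∈ closedNbhd T y := by
  rw [mem_closedNbhd, mem_closedNbhd, T.adj_comm, eq_comm]

/-- The action of the lifted Jacobi matrix on functions on the vertices of `T`. -/
def jacobiAct (Ξ : GraphCovering T G) (b : V → ℝ) (a : E → ℝ) [T.LocallyFinite]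
    (u : W → ℂ) (x : W) : ℂ :=
  ∑ y ∈ closedNbhd T x, (Ξ.entry b a x y : ℂ) * u y

theorem card_closedNbhd_le [Fintype E] (Ξ : GraphCovering T G) [T.LocallyFinite] (x : W) :
    (closedNbhd T x).card ≤ Fintype.card (E × Bool) + 1 := by
  classical
  refine (Finset.card_insert_le _ _).trans (Nat.add_le_add_right ?_ 1)
  rw [SimpleGraph.card_neighborFinset_eq_degree, ← SimpleGraph.card_neighborSet_eq_degree]
  refine Fintype.card_le_of_injective
    (fun y : T.neighborSet x => Ξ.onDart ⟨(x, y.1), y.2⟩) fun y z h => ?_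
  have := (Ξ.bijOn_star x).injOn (by simp) (by simp) h
  exact Subtype.ext (congrArg (fun d : T.Dart => d.snd) this)

variable [Fintype V] [Fintype E]

theorem abs_entry_le (Ξ : GraphCovering T G) (b : V → ℝ) (a : E → ℝ) (x y : W) :
    |Ξ.entry b a x y| ≤ (∑ v, |b v|) + ∑ e, |a e| := by
  have hb : ∀ v, |b v| ≤ ∑ v, |b v| := fun v =>
    Finset.single_le_sum (f := fun v => |b v|) (fun _ _ => abs_nonneg _) (Finset.mem_univ v)
  have ha : ∀ e, |a e| ≤ ∑ e, |a e| := fun e =>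
    Finset.single_le_sum (f := fun e => |a e|) (fun _ _ => abs_nonneg _) (Finset.mem_univ e)
  have hb0 : 0 ≤ ∑ v, |b v| := Finset.sum_nonneg fun _ _ => abs_nonneg _
  have ha0 : 0 ≤ ∑ e, |a e| := Finset.sum_nonneg fun _ _ => abs_nonneg _
  unfold entry
  split_ifs with h1 h2
  · linarith [hb (Ξ.onVert x)]
  · linarith [ha (Ξ.onDart ⟨(x, y), h2⟩).1]
  · simpa using add_nonneg hb0 ha0

/-- A bound for the operator norm of the lifted Jacobi matrix. -/
def jacobiBound (b : V → ℝ) (a : E → ℝ) : ℝ :=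
  ((Fintype.card (E × Bool) + 1 : ℕ) : ℝ) * ((∑ v, |b v|) + ∑ e, |a e|)

theorem jacobiBound_nonneg (b : V → ℝ) (a : E → ℝ) : 0 ≤ jacobiBound b a := by
  unfold jacobiBound
  exact mul_nonneg (Nat.cast_nonneg _) (add_nonneg (Finset.sum_nonneg fun _ _ => abs_nonneg _)
    (Finset.sum_nonneg fun _ _ => abs_nonneg _))

theorem sum_norm_jacobiAct_sq_le (Ξ : GraphCovering T G) (b : V → ℝ) (a : E → ℝ) [T.LocallyFinite]
    (u : VertexSpace W) (s : Finset W) :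
    ∑ x ∈ s, ‖Ξ.jacobiAct b a u x‖ ^ 2 ≤ (jacobiBound b a * ‖u‖) ^ 2 := by
  classical
  set D : ℕ := Fintype.card (E × Bool) + 1 with hD
  set C : ℝ := (∑ v, |b v|) + ∑ e, |a e| with hC
  have h1 : ∀ x, ‖Ξ.jacobiAct b a u x‖ ^ 2 ≤ D * C ^ 2 * ∑ y ∈ closedNbhd T x, ‖u y‖ ^ 2 := by
    intro x
    have hn : ‖Ξ.jacobiAct b a u x‖ ≤ ∑ y ∈ closedNbhd T x, C * ‖u y‖ := by
      refine (norm_sum_le _ _).trans (Finset.sum_le_sum fun y _ => ?_)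
      rw [norm_mul, Complex.norm_real, Real.norm_eq_abs]
      exact mul_le_mul_of_nonneg_right (Ξ.abs_entry_le b a x y) (norm_nonneg _)
    calc ‖Ξ.jacobiAct b a u x‖ ^ 2 ≤ (∑ y ∈ closedNbhd T x, C * ‖u y‖) ^ 2 := by gcongr
      _ ≤ (closedNbhd T x).card * ∑ y ∈ closedNbhd T x, (C * ‖u y‖) ^ 2 :=
          sq_sum_le_card_mul_sum_sq
      _ ≤ D * ∑ y ∈ closedNbhd T x, (C * ‖u y‖) ^ 2 := by
          gcongr
          exact Ξ.card_closedNbhd_le x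
      _ = D * C ^ 2 * ∑ y ∈ closedNbhd T x, ‖u y‖ ^ 2 := by
          rw [mul_assoc, Finset.mul_sum _ _ (C ^ 2)]
          simp only [mul_pow]
  have h2 : ∑ x ∈ s, ∑ y ∈ closedNbhd T x, ‖u y‖ ^ 2 ≤ D * ‖u‖ ^ 2 := by
    have hsw : ∑ x ∈ s, ∑ y ∈ closedNbhd T x, ‖u y‖ ^ 2
        = ∑ y ∈ s.biUnion (closedNbhd T), ∑ x ∈ s with y ∈ closedNbhd T x, ‖u y‖ ^ 2 := by
      refine Finset.sum_comm' fun x y => ?_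
      simp only [Finset.mem_biUnion, Finset.mem_filter]
      constructor
      · rintro ⟨hx, hy⟩
        exact ⟨⟨hx, hy⟩, x, hx, hy⟩
      · rintro ⟨h, -⟩
        exact h
    rw [hsw]
    calc ∑ y ∈ s.biUnion (closedNbhd T), ∑ x ∈ s with y ∈ closedNbhd T x, ‖u y‖ ^ 2
        ≤ ∑ y ∈ s.biUnion (closedNbhd T), D * ‖u y‖ ^ 2 := by
          refine Finset.sum_le_sum fun y _ => ?_
          rw [Finset.sum_const, nsmul_eq_mul]
          gcongr
          refine (Finset.card_le_card fun x hx => ?_).trans (Ξ.card_closedNbhd_le y)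
          exact mem_closedNbhd_comm.1 (Finset.mem_filter.1 hx).2
      _ = D * ∑ y ∈ s.biUnion (closedNbhd T), ‖u y‖ ^ 2 := by rw [Finset.mul_sum]
      _ ≤ D * ‖u‖ ^ 2 := by
          gcongr
          have := lp.sum_rpow_le_norm_rpow (p := 2) (by norm_num) u (s.biUnion (closedNbhd T))
          simpa using this
  calc ∑ x ∈ s, ‖Ξ.jacobiAct b a u x‖ ^ 2
      ≤ ∑ x ∈ s, D * C ^ 2 * ∑ y ∈ closedNbhd T x, ‖u y‖ ^ 2 := Finset.sum_le_sum fun x _ => h1 x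
    _ = D * C ^ 2 * ∑ x ∈ s, ∑ y ∈ closedNbhd T x, ‖u y‖ ^ 2 := by rw [Finset.mul_sum]
    _ ≤ D * C ^ 2 * (D * ‖u‖ ^ 2) := by gcongr
    _ = (jacobiBound b a * ‖u‖) ^ 2 := by rw [jacobiBound, ← hD, ← hC]; ring

theorem memℓp_jacobiAct (Ξ : GraphCovering T G) (b : V → ℝ) (a : E → ℝ) [T.LocallyFinite]
    (u : VertexSpace W) : Memℓp (Ξ.jacobiAct b a u) 2 :=
  memℓp_gen' (C := (jacobiBound b a * ‖u‖) ^ 2) fun s => by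
    simpa using Ξ.sum_norm_jacobiAct_sq_le b a u s

/-- The periodic Jacobi matrix on `T`, as a bounded operator on `ℓ²(W)`: the lift along the covering
map of the Jacobi matrix on `G` with parameters `b` at the vertices and `a` at the edges. -/
def jacobi (Ξ : GraphCovering T G) (b : V → ℝ) (a : E → ℝ) [T.LocallyFinite] :
    VertexSpace W →L[ℂ] VertexSpace W :=
  LinearMap.mkContinuous
    { toFun := fun u => ⟨Ξ.jacobiAct b a u, Ξ.memℓp_jacobiAct b a u⟩
      map_add' := fun u v => by
        refine lp.ext (funext fun x => ?_)
        change Ξ.jacobiAct b a (u + v : VertexSpace W) x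
          = Ξ.jacobiAct b a u x + Ξ.jacobiAct b a v x
        simp [jacobiAct, mul_add, Finset.sum_add_distrib]
      map_smul' := fun c u => by
        ext x
        simp [jacobiAct, Finset.mul_sum, mul_left_comm] }
    (jacobiBound b a)
    fun u => lp.norm_le_of_forall_sum_le (by norm_num)
      (mul_nonneg (jacobiBound_nonneg b a) (norm_nonneg u)) fun s => by
        simpa using Ξ.sum_norm_jacobiAct_sq_le b a u s

theorem jacobi_apply (Ξ : GraphCovering T G) (b : V → ℝ) (a : E → ℝ) [T.LocallyFinite]
    (u : VertexSpace W) (x : W) :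
    Ξ.jacobi b a u x = ∑ y ∈ closedNbhd T x, (Ξ.entry b a x y : ℂ) * u y := rfl

end GraphCovering

section SpectralMeasure

variable {𝓗 : Type*} [NormedAddCommGroup 𝓗] [InnerProductSpace ℂ 𝓗] [CompleteSpace 𝓗]

open scoped CompactlySupported

/-- For a bounded self-adjoint operator `H` and a vector `v`, the positive linear functional
`f ↦ ⟪v, f(H) v⟫` on continuous functions of compact support. -/
def spectralFunctional (H : 𝓗 →L[ℂ] 𝓗) (v : 𝓗) : C_c(ℝ, ℝ) →ₚ[ℝ] ℝ :=
  PositiveLinearMap.mk₀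
    { toFun := fun f => (inner ℂ v (cfc (fun t : ℝ => f t) H v)).re
      map_add' := fun f g => by
        have h := cfc_add (a := H) (fun t : ℝ => f t) (fun t : ℝ => g t)
          (map_continuous f).continuousOn (map_continuous g).continuousOn
        simp only [CompactlySupportedContinuousMap.coe_add, Pi.add_apply]
        rw [h]
        simp
      map_smul' := fun c f => by
        have h := cfc_smul (a := H) c (fun t : ℝ => f t) (map_continuous f).continuousOn
        simp only [CompactlySupportedContinuousMap.coe_smul, Pi.smul_apply]
        rw [h]
        simp [inner_smul_right_eq_smul] }
    (fun f hf => by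
      have h : 0 ≤ cfc (fun t : ℝ => f t) H := cfc_nonneg fun t _ => hf t
      rw [ContinuousLinearMap.nonneg_iff_isPositive] at h
      exact h.re_inner_nonneg_right v)

/-- The spectral measure of the bounded self-adjoint operator `H` at the vector `v`: the measure
`μ` on `ℝ` with `⟪v, f(H) v⟫ = ∫ f dμ`. -/
def spectralMeasure (H : 𝓗 →L[ℂ] 𝓗) (v : 𝓗) : MeasureTheory.Measure ℝ :=
  RealRMK.rieszMeasure (spectralFunctional H v)

end SpectralMeasure

/-- The density of states of an operator `H` on `ℓ²(W)`, given one vertex `r j` of `W` over each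
vertex `j` of the finite graph: the average over `j` of the spectral measures of `H` at the unit
vectors supported at `r j`. -/
def densityOfStates {V W : Type*} [Fintype V] [DecidableEq W]
    (H : VertexSpace W →L[ℂ] VertexSpace W) (r : V → W) : MeasureTheory.Measure ℝ :=
  (Fintype.card V : ENNReal)⁻¹ • ∑ j : V, spectralMeasure H (lp.single 2 (r j) (1 : ℂ))

/-- The integrated density of states: the mass which the density of states gives to
`(-∞, t)`. -/
def integratedDensityOfStates {V W : Type*} [Fintype V] [DecidableEq W]
    (H : VertexSpace W →L[ℂ] VertexSpace W) (r : V → W) (t : ℝ) : ℝ :=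
  (densityOfStates H r).real (Set.Iio t)

/-- `(α, β)` is a gap of the closed set `S`, that is, a bounded connected component of the
complement of `S`. -/
def IsGap (S : Set ℝ) (α β : ℝ) : Prop :=
  α < β ∧ α ∈ S ∧ β ∈ S ∧ Disjoint (Set.Ioo α β) S

end

/-!
Write `R = (z - H)⁻¹`. By invariance under deck transformations (`exists_deck_equiv`,
`matrixElement_deck`), the diagonal elements of `R` depend only on the vertex `v` of `G` below, and
the elements between neighbours only on the directed edge `d` of `G` below; call them `ρ v` and
`η d`. The equation `(z - H) R = 1` gives a relation at each vertex,
`(z - b v) ρ v - ∑ a η = 1`, the sum being over the directed edges from `v`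
(`matrixElement_row`). Cutting a column of `R` off along one edge of the tree gives a relation at
each edge, `a (ρ ρ' - η ^ 2) = η`, where `ρ` and `ρ'` belong to the two ends (`matrixElement_edge`).

These relations imply that `Φ = ∏ (1 + a η) / ∏ ρ`, with products over the edges and over the
vertices of `G`, satisfies `Φ' = (∑ ρ) Φ` (`sum_logDeriv_eq`). So the trace per period `∑ ρ` is a
logarithmic derivative of a single-valued function. Choose a point `t₀` of a gap at which no `ρ v`
vanishes; there is one, as each `ρ v` is strictly monotone in the gap
(`exists_stieltjesLine_ne_zero`). Along the line `t₀ + i y`, the quotient `Φ(y) / Φ(-y)` is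
`exp (2 i θ(y))`, where `θ(y)` is the sum over `v` of `∫ arctan (y / (t₀ - t)) dμ_v(t)`. As
`y → ∞`, the quotient tends to `(-1) ^ p`, because `Φ` grows like `(i y) ^ p`, and `θ` tends to
`(π / 2) (2 N - p)` with `N = ∑ μ_v (-∞, t₀)`. Hence `exp (2 π i N) = 1`, and `N = p k(t₀)` is an
integer (`exists_int_sum_measureReal_Iio`).

An open set that meets the spectrum has positive mass for some `μ_v`
(`sum_spectralMeasure_real_pos`). This gives `0 < N < p`, and it shows that `N` increases from one
gap to the next. So there are at most `p - 1` gaps and at most `p` intervals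
(`exists_iUnion_Icc_of_gap_labels`).
-/

noncomputable section

/-! ### Deck transformations of the universal cover -/

namespace GraphCovering

variable {V E W : Type*} {T : SimpleGraph W} {G : Multigraph V E}

theorem onVert_snd (Ξ : GraphCovering T G) (d : T.Dart) :
    Ξ.onVert d.snd = G.target (Ξ.onDart d) := by
  rw [Multigraph.target, ← Ξ.onDart_symm, Ξ.source_onDart]
  rfl

theorem exists_lift_dart (Ξ : GraphCovering T G) {x : W} {e : G.Dart}
    (he : G.source e = Ξ.onVert x) : ∃ (y : W) (h : T.Adj x y), Ξ.onDart ⟨(x, y), h⟩ = e := by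
  obtain ⟨⟨⟨x', y⟩, h⟩, hd, rfl⟩ := (Ξ.bijOn_star x).surjOn he
  obtain rfl : x' = x := hd
  exact ⟨y, h, rfl⟩

theorem eq_of_onDart_eq (Ξ : GraphCovering T G) {x y z : W} (hy : T.Adj x y) (hz : T.Adj x z)
    (h : Ξ.onDart ⟨(x, y), hy⟩ = Ξ.onDart ⟨(x, z), hz⟩) : y = z := by
  have := (Ξ.bijOn_star x).injOn (by simp) (by simp) h
  exact congrArg (fun d : T.Dart => d.snd) this

theorem exists_step (Ξ : GraphCovering T G) {u w u' : W} (hu : Ξ.onVert u' = Ξ.onVert u)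
    (h : T.Adj u w) : ∃ (y : W) (h' : T.Adj u' y),
      Ξ.onDart ⟨(u', y), h'⟩ = Ξ.onDart ⟨(u, w), h⟩ :=
  Ξ.exists_lift_dart (by rw [hu]; exact Ξ.source_onDart _)

/-- The end of the edge of `T` at a point `s` of the fibre through `u` that has the same image as
the edge from `u` to `w`. -/
def step (Ξ : GraphCovering T G) {u w : W} (h : T.Adj u w)
    (s : {u' // Ξ.onVert u' = Ξ.onVert u}) : {w' // Ξ.onVert w' = Ξ.onVert w} :=
  ⟨(Ξ.exists_step s.2 h).choose, by
    obtain ⟨h', e⟩ := (Ξ.exists_step s.2 h).choose_spec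
    exact (Ξ.onVert_snd ⟨(_, _), h'⟩).trans
      ((congrArg G.target e).trans (Ξ.onVert_snd ⟨(u, w), h⟩).symm)⟩

theorem adj_step (Ξ : GraphCovering T G) {u w : W} (h : T.Adj u w)
    (s : {u' // Ξ.onVert u' = Ξ.onVert u}) : ∃ h' : T.Adj s.1 (Ξ.step h s).1,
      Ξ.onDart ⟨(s.1, (Ξ.step h s).1), h'⟩ = Ξ.onDart ⟨(u, w), h⟩ :=
  (Ξ.exists_step s.2 h).choose_spec

/-- The end of the lift, starting at a given point of the fibre through `u`, of the image in `G` of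
a walk from `u`. -/
def liftWalk (Ξ : GraphCovering T G) : ∀ {u w : W}, T.Walk u w →
    {u' // Ξ.onVert u' = Ξ.onVert u} → {w' // Ξ.onVert w' = Ξ.onVert w}
  | _, _, .nil, s => s
  | _, _, .cons h p, s => liftWalk Ξ p (Ξ.step h s)

theorem liftWalk_concat (Ξ : GraphCovering T G) {u v w : W} (p : T.Walk u v) (h : T.Adj v w)
    (s : {u' // Ξ.onVert u' = Ξ.onVert u}) :
    Ξ.liftWalk (p.concat h) s = Ξ.step h (Ξ.liftWalk p s) := by
  induction p with
  | nil => rfl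
  | cons h' p ih => simpa [SimpleGraph.Walk.concat_cons, liftWalk] using ih h (Ξ.step h' s)

/-- A map of `T` to itself over `G`: it respects edges and the images of vertices and edges under
the covering map. Bijectivity is not part of the definition. -/
structure IsDeckMap (Ξ : GraphCovering T G) (φ : W → W) : Prop where
  onVert (w : W) : Ξ.onVert (φ w) = Ξ.onVert w
  onDart {u w : W} (h : T.Adj u w) :
    ∃ h' : T.Adj (φ u) (φ w), Ξ.onDart ⟨(φ u, φ w), h'⟩ = Ξ.onDart ⟨(u, w), h⟩

theorem IsDeckMap.id (Ξ : GraphCovering T G) : Ξ.IsDeckMap id :=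
  ⟨fun _ => rfl, fun h => ⟨h, rfl⟩⟩

theorem IsDeckMap.comp {Ξ : GraphCovering T G} {φ ψ : W → W} (hφ : Ξ.IsDeckMap φ)
    (hψ : Ξ.IsDeckMap ψ) : Ξ.IsDeckMap (φ ∘ ψ) where
  onVert w := (hφ.onVert _).trans (hψ.onVert w)
  onDart h := by
    obtain ⟨h1, e1⟩ := hψ.onDart h
    obtain ⟨h2, e2⟩ := hφ.onDart h1
    exact ⟨h2, e2.trans e1⟩

/-- Uniqueness of lifts: a map over `G` is determined by its value at one vertex. -/
theorem IsDeckMap.eq_of_eq {Ξ : GraphCovering T G} {φ ψ : W → W} (hφ : Ξ.IsDeckMap φ)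
    (hψ : Ξ.IsDeckMap ψ) (hT : T.Connected) {x : W} (hx : φ x = ψ x) : φ = ψ := by
  funext w
  obtain ⟨p⟩ := hT.preconnected x w
  induction p with
  | nil => exact hx
  | @cons u v w h p ih =>
    refine ih ?_
    obtain ⟨h1, e1⟩ := hφ.onDart h
    obtain ⟨h2, e2⟩ := hψ.onDart h
    have h3 : T.Adj (φ u) (ψ v) := hx ▸ h2
    refine Ξ.eq_of_onDart_eq h1 h3 (e1.trans ?_)
    rw [← e2]
    congr 3
    exact hx.symm

/-- In a tree, lifting along the unique path from a base point respects all edges, since of two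
adjacent vertices the path to one extends the path to the other. -/
theorem exists_isDeckMap (Ξ : GraphCovering T G) (hT : T.IsTree) {x x' : W}
    (h : Ξ.onVert x' = Ξ.onVert x) : ∃ φ : W → W, Ξ.IsDeckMap φ ∧ φ x = x' := by
  choose p hp _ using hT.existsUnique_path x
  have key : ∀ {u w : W} (hadj : T.Adj u w), u ∈ (p w).support →
      Ξ.liftWalk (p w) ⟨x', h⟩ = Ξ.step hadj (Ξ.liftWalk (p u) ⟨x', h⟩) := by
    intro u w hadj hu
    rw [hT.isAcyclic.path_concat (hp u) (hp w) hadj hu, liftWalk_concat]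
  refine ⟨fun w => (Ξ.liftWalk (p w) ⟨x', h⟩).1, ⟨fun w => (Ξ.liftWalk (p w) ⟨x', h⟩).2, ?_⟩, ?_⟩
  · intro u w hadj
    by_cases hu : u ∈ (p w).support
    · simp only [key hadj hu]
      exact Ξ.adj_step hadj _
    · have hw := hT.isAcyclic.mem_support_of_ne_mem_support_of_adj_of_isPath (hp u) (hp w) hadj hu
      simp only [key hadj.symm hw]
      obtain ⟨h', e⟩ := Ξ.adj_step hadj.symm (Ξ.liftWalk (p w) ⟨x', h⟩)
      refine ⟨h'.symm, ?_⟩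
      have h1 := Ξ.onDart_symm ⟨(_, _), h'⟩
      rw [e] at h1
      have h2 := Ξ.onDart_symm ⟨(u, w), hadj⟩
      refine h1.trans ?_
      change G.reverse (Ξ.onDart (SimpleGraph.Dart.symm ⟨(u, w), hadj⟩)) = _
      rw [h2]
      simp [Multigraph.reverse]
  · have : p x = .nil := (SimpleGraph.Walk.isPath_iff_nil.1 (hp x)).eq_nil
    simp [this, liftWalk]

/-- The universal cover is normal: its deck transformations act transitively on each fibre. -/
theorem exists_deck_equiv (Ξ : GraphCovering T G) (hT : T.IsTree) {x x' : W}
    (h : Ξ.onVert x' = Ξ.onVert x) :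
    ∃ φ : W ≃ W, Ξ.IsDeckMap φ ∧ Ξ.IsDeckMap φ.symm ∧ φ x = x' := by
  obtain ⟨φ, hφ, hx⟩ := Ξ.exists_isDeckMap hT h
  obtain ⟨ψ, hψ, hx'⟩ := Ξ.exists_isDeckMap hT h.symm
  refine ⟨⟨φ, ψ, congrFun ((hψ.comp hφ).eq_of_eq (.id Ξ) hT.connected (x := x) ?_),
    congrFun ((hφ.comp hψ).eq_of_eq (.id Ξ) hT.connected (x := x') ?_)⟩, hφ, hψ, hx⟩
  · simp [hx, hx']
  · simp [hx, hx']

theorem IsDeckMap.entry_eq {Ξ : GraphCovering T G} {φ : W ≃ W} (hφ : Ξ.IsDeckMap φ)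
    (hφ' : Ξ.IsDeckMap φ.symm) (b : V → ℝ) (a : E → ℝ) (x y : W) :
    Ξ.entry b a (φ x) (φ y) = Ξ.entry b a x y := by
  unfold entry
  by_cases hxy : x = y
  · simp [hxy, hφ.onVert]
  have hne : φ x ≠ φ y := fun h => hxy (φ.injective h)
  by_cases hadj : T.Adj x y
  · obtain ⟨h', e⟩ := hφ.onDart hadj
    simp [hxy, hadj, h', e]
  · have : ¬ T.Adj (φ x) (φ y) := fun h => hadj (by simpa using (hφ'.onDart h).1)
    simp [hxy, hadj, this]

theorem entry_comm (Ξ : GraphCovering T G) (b : V → ℝ) (a : E → ℝ) (x y : W) :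
    Ξ.entry b a x y = Ξ.entry b a y x := by
  unfold entry
  by_cases hxy : x = y
  · simp [hxy]
  by_cases hadj : T.Adj x y
  · have h := Ξ.onDart_symm ⟨(x, y), hadj⟩
    have h1 : (Ξ.onDart ⟨(y, x), hadj.symm⟩).1 = (Ξ.onDart ⟨(x, y), hadj⟩).1 :=
      (congrArg Prod.fst h :)
    simp [hxy, Ne.symm hxy, hadj, hadj.symm, h1]
  · have hadj' : ¬ T.Adj y x := fun h => hadj h.symm
    simp [hxy, Ne.symm hxy, hadj, hadj']

theorem entry_self (Ξ : GraphCovering T G) (b : V → ℝ) (a : E → ℝ) (x : W) :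
    Ξ.entry b a x x = b (Ξ.onVert x) := by simp [entry]

theorem entry_of_adj (Ξ : GraphCovering T G) (b : V → ℝ) (a : E → ℝ) {x y : W} (h : T.Adj x y) :
    Ξ.entry b a x y = a (Ξ.onDart ⟨(x, y), h⟩).1 := by simp [entry, h, h.ne]

end GraphCovering

/-! ### Operators on `ℓ²` of the vertices -/

section VertexSpace

variable {W : Type*}

/-- The unitary operator on `ℓ²(W)` which a permutation of `W` induces. -/
def permuteVertexSpace (φ : W ≃ W) : VertexSpace W →ₗᵢ[ℂ] VertexSpace W where
  toFun u := ⟨fun w => u (φ.symm w), by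
    refine memℓp_gen ?_
    exact φ.symm.summable_iff.2 ((lp.memℓp u).summable (by norm_num))⟩
  map_add' u v := rfl
  map_smul' c u := rfl
  norm_map' u := by
    rw [lp.norm_eq_tsum_rpow (by norm_num), lp.norm_eq_tsum_rpow (by norm_num)]
    congr 1
    exact φ.symm.tsum_eq (fun w => ‖u w‖ ^ (2 : ENNReal).toReal)

theorem permuteVertexSpace_apply (φ : W ≃ W) (u : VertexSpace W) (w : W) :
    permuteVertexSpace φ u w = u (φ.symm w) := rfl

variable [DecidableEq W]

theorem permuteVertexSpace_single (φ : W ≃ W) (x : W) :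
    permuteVertexSpace φ (lp.single 2 x (1 : ℂ)) = lp.single 2 (φ x) (1 : ℂ) := by
  ext w
  rw [permuteVertexSpace_apply, lp.single_apply, lp.single_apply]
  simp only [Pi.single_apply, Equiv.symm_apply_eq]

/-- The matrix element of an operator on `ℓ²(W)` in row `x` and column `y`. -/
def matrixElement (x y : W) : (VertexSpace W →L[ℂ] VertexSpace W) →L[ℂ] ℂ :=
  (innerSL ℂ (lp.single 2 x (1 : ℂ))).comp
    (ContinuousLinearMap.apply ℂ (VertexSpace W) (lp.single 2 y (1 : ℂ) : VertexSpace W))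

theorem matrixElement_eq_inner (x y : W) (A : VertexSpace W →L[ℂ] VertexSpace W) :
    matrixElement x y A = inner ℂ (lp.single 2 x (1 : ℂ)) (A (lp.single 2 y (1 : ℂ))) := rfl

theorem inner_single_one (x : W) (u : VertexSpace W) :
    inner ℂ (lp.single 2 x (1 : ℂ)) u = u x := by
  rw [lp.inner_single_left]
  simp

theorem matrixElement_apply (x y : W) (A : VertexSpace W →L[ℂ] VertexSpace W) :
    matrixElement x y A = A (lp.single 2 y (1 : ℂ)) x := by
  rw [matrixElement_eq_inner, inner_single_one]

theorem matrixElement_permute {φ : W ≃ W} {A : VertexSpace W →L[ℂ] VertexSpace W}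
    (h : Commute A (permuteVertexSpace φ).toContinuousLinearMap) (x y : W) :
    matrixElement (φ x) (φ y) A = matrixElement x y A := by
  have h1 := DFunLike.congr_fun h.eq (lp.single 2 y (1 : ℂ))
  change A (permuteVertexSpace φ _) = permuteVertexSpace φ (A _) at h1
  rw [matrixElement_apply, matrixElement_apply, ← permuteVertexSpace_single, h1,
    permuteVertexSpace_apply, Equiv.symm_apply_apply]

theorem eq_zero_of_apply_single {A : VertexSpace W →L[ℂ] VertexSpace W}
    (h : ∀ x, A (lp.single 2 x (1 : ℂ)) = 0) : A = 0 := by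
  ext1 u
  have h1 := (lp.hasSum_single (p := 2) (by norm_num) u).mapL A
  have h2 : ∀ x, A (lp.single 2 x (u x)) = 0 := fun x => by
    have : (lp.single 2 x (u x) : VertexSpace W) = u x • lp.single 2 x (1 : ℂ) := by
      rw [← lp.single_smul]; simp
    rw [this, map_smul, h, smul_zero]
  simp only [h2] at h1
  exact h1.unique hasSum_zero

end VertexSpace

namespace GraphCovering

variable {V E W : Type*} {T : SimpleGraph W} {G : Multigraph V E}

/-- The end of the edge of `T` that starts at `x` and lies over a given directed edge of `G`
(the vertex `x` itself, if there is none). -/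
def liftEnd (Ξ : GraphCovering T G) (x : W) (e : G.Dart) : W := by
  classical
  exact if h : ∃ (y : W) (h : T.Adj x y), Ξ.onDart ⟨(x, y), h⟩ = e then h.choose else x

theorem adj_liftEnd (Ξ : GraphCovering T G) {x : W} {e : G.Dart} (he : G.source e = Ξ.onVert x) :
    ∃ h : T.Adj x (Ξ.liftEnd x e), Ξ.onDart ⟨(x, Ξ.liftEnd x e), h⟩ = e := by
  have h := Ξ.exists_lift_dart he
  have : Ξ.liftEnd x e = h.choose := by simp [liftEnd, h]
  rw [this]
  exact h.choose_spec

theorem liftEnd_eq (Ξ : GraphCovering T G) {x y : W} (h : T.Adj x y) :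
    Ξ.liftEnd x (Ξ.onDart ⟨(x, y), h⟩) = y := by
  obtain ⟨h', e⟩ := Ξ.adj_liftEnd (Ξ.source_onDart ⟨(x, y), h⟩)
  exact Ξ.eq_of_onDart_eq h' h e

variable [Fintype V] [Fintype E] [T.LocallyFinite]

theorem jacobi_single [DecidableEq W] (Ξ : GraphCovering T G) (b : V → ℝ) (a : E → ℝ) (x : W) :
    Ξ.jacobi b a (lp.single 2 x (1 : ℂ))
      = ∑ y ∈ closedNbhd T x, (Ξ.entry b a x y : ℂ) • lp.single 2 y (1 : ℂ) := by
  ext w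
  rw [jacobi_apply, lp.coeFn_sum, Finset.sum_apply]
  simp only [lp.coeFn_smul, Pi.smul_apply, lp.single_apply, Pi.single_apply, smul_eq_mul,
    mul_ite, mul_one, mul_zero, Finset.sum_ite_eq, Finset.sum_ite_eq']
  simp only [mem_closedNbhd_comm (x := w), Ξ.entry_comm b a w]

theorem isSelfAdjoint_jacobi (Ξ : GraphCovering T G) (b : V → ℝ) (a : E → ℝ) :
    IsSelfAdjoint (Ξ.jacobi b a) := by
  classical
  rw [ContinuousLinearMap.isSelfAdjoint_iff']
  ext u x
  rw [← inner_single_one, ContinuousLinearMap.adjoint_inner_right, jacobi_single, sum_inner,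
    jacobi_apply]
  refine Finset.sum_congr rfl fun y _ => ?_
  rw [inner_smul_left, inner_single_one, Complex.conj_ofReal]

theorem jacobi_commute {Ξ : GraphCovering T G} (b : V → ℝ) (a : E → ℝ) {φ : W ≃ W}
    (hφ : Ξ.IsDeckMap φ) (hφ' : Ξ.IsDeckMap φ.symm) :
    Commute (Ξ.jacobi b a) (permuteVertexSpace φ).toContinuousLinearMap := by
  refine ContinuousLinearMap.ext fun u => lp.ext (funext fun w => ?_)
  change Ξ.jacobi b a (permuteVertexSpace φ u) w = permuteVertexSpace φ (Ξ.jacobi b a u) w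
  rw [permuteVertexSpace_apply, jacobi_apply, jacobi_apply]
  symm
  refine Finset.sum_bij (fun y _ => φ y) (fun y hy => ?_) (fun _ _ _ _ h => φ.injective h)
    (fun y hy => ?_) fun y _ => ?_
  · rw [mem_closedNbhd] at hy ⊢
    refine hy.imp (fun h => by simp [h]) fun h => ?_
    simpa using (hφ.onDart h).1
  · refine ⟨φ.symm y, ?_, by simp⟩
    rw [mem_closedNbhd] at hy ⊢
    exact hy.imp (fun h => by simp [h]) fun h => (hφ'.onDart h).1
  · rw [permuteVertexSpace_apply, Equiv.symm_apply_apply, ← hφ.entry_eq hφ']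
    simp

/-- The Green's function is invariant under deck transformations. -/
theorem matrixElement_deck [DecidableEq W] {Ξ : GraphCovering T G} (b : V → ℝ) (a : E → ℝ)
    {φ : W ≃ W} (hφ : Ξ.IsDeckMap φ) (hφ' : Ξ.IsDeckMap φ.symm) (z : ℂ) (x y : W) :
    matrixElement (φ x) (φ y) (resolvent (Ξ.jacobi b a) z)
      = matrixElement x y (resolvent (Ξ.jacobi b a) z) := by
  refine matrixElement_permute ?_ x y
  have h : Commute (algebraMap ℂ _ z - Ξ.jacobi b a) (permuteVertexSpace φ).toContinuousLinearMap :=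
    Commute.sub_left (Algebra.commutes z _) (jacobi_commute b a hφ hφ')
  unfold resolvent
  by_cases hu : IsUnit (algebraMap ℂ _ z - Ξ.jacobi b a)
  · obtain ⟨v, hv⟩ := hu
    rw [← hv] at h ⊢
    rw [Ring.inverse_unit]
    exact h.units_inv_left
  · rw [Ring.inverse_non_unit _ hu]
    exact Commute.zero_left _

theorem jacobi_apply_eq_sum_darts [DecidableEq V] (Ξ : GraphCovering T G) (b : V → ℝ) (a : E → ℝ)
    (u : VertexSpace W) (x : W) :
    Ξ.jacobi b a u x = b (Ξ.onVert x) * u x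
      + ∑ e : E × Bool with G.source e = Ξ.onVert x, a e.1 * u (Ξ.liftEnd x e) := by
  classical
  rw [jacobi_apply, closedNbhd, Finset.sum_insert (by simp), entry_self]
  congr 1
  symm
  refine Finset.sum_bij (fun e _ => Ξ.liftEnd x e) (fun e he => ?_) (fun e he e' he' h => ?_)
    (fun y hy => ?_) fun e he => ?_
  · simpa using (Ξ.adj_liftEnd (Finset.mem_filter.1 he).2).1
  · obtain ⟨h1, e1⟩ := Ξ.adj_liftEnd (Finset.mem_filter.1 he).2
    obtain ⟨h2, e2⟩ := Ξ.adj_liftEnd (Finset.mem_filter.1 he').2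
    rw [← e1, ← e2]
    congr 3
  · have hy' : T.Adj x y := by simpa using hy
    exact ⟨Ξ.onDart ⟨(x, y), hy'⟩, by simpa using Ξ.source_onDart _, Ξ.liftEnd_eq hy'⟩
  · obtain ⟨h1, e1⟩ := Ξ.adj_liftEnd (Finset.mem_filter.1 he).2
    rw [entry_of_adj Ξ b a h1, e1]

end GraphCovering

/-! ### Relations for the Green's function on a tree -/

/-- The restriction of a square-summable function to a set of vertices. -/
def VertexSpace.indicator {W : Type*} (S : Set W) (u : VertexSpace W) : VertexSpace W :=
  ⟨S.indicator u, by
    refine memℓp_gen (Summable.of_nonneg_of_le (fun _ => by positivity) (fun w => ?_)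
      ((lp.memℓp u).summable (by norm_num)))
    gcongr
    exact norm_indicator_le_norm_self _ _⟩

theorem VertexSpace.indicator_apply {W : Type*} (S : Set W) (u : VertexSpace W) (w : W) :
    VertexSpace.indicator S u w = S.indicator u w := rfl

/-- Deleting an edge of a tree leaves a side containing one end only, and no other edge leads out
of that side. -/
theorem SimpleGraph.IsAcyclic.exists_side {W : Type*} {T : SimpleGraph W} (hT : T.IsAcyclic)
    {x y : W} (h : T.Adj x y) : ∃ S : Set W, x ∈ S ∧ y ∉ S ∧
      ∀ u w, T.Adj u w → u ∈ S → w ∉ S → u = x ∧ w = y := by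
  have hb := SimpleGraph.isBridge_iff.1 (SimpleGraph.isAcyclic_iff_forall_adj_isBridge.1 hT h)
  refine ⟨{w | (T.deleteEdges {s(x, y)}).Reachable x w}, SimpleGraph.Reachable.refl x, hb,
    fun u w huw hu hw => ?_⟩
  by_cases he : s(u, w) = s(x, y)
  · rcases Sym2.eq_iff.1 he with h1 | ⟨rfl, rfl⟩
    · exact h1
    · exact absurd hu hb
  · refine absurd (SimpleGraph.Reachable.trans hu (SimpleGraph.Adj.reachable ?_)) hw
    rw [SimpleGraph.deleteEdges_adj]
    exact ⟨huw, by simpa using he⟩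

theorem resolvent_mul_cancel {A : Type*} [Ring A] [Algebra ℂ A] {H : A} {z : ℂ}
    (hz : z ∈ resolventSet ℂ H) : resolvent H z * (algebraMap ℂ A z - H) = 1 :=
  Ring.inverse_mul_cancel _ hz

theorem mul_resolvent_cancel {A : Type*} [Ring A] [Algebra ℂ A] {H : A} {z : ℂ}
    (hz : z ∈ resolventSet ℂ H) : (algebraMap ℂ A z - H) * resolvent H z = 1 :=
  Ring.mul_inverse_cancel _ hz

namespace GraphCovering

variable {V E W : Type*} {T : SimpleGraph W} {G : Multigraph V E} [Fintype V] [Fintype E]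
  [T.LocallyFinite] [DecidableEq W]

/-- Cutting a function off along one edge `xy` of a tree disturbs the action of the Jacobi matrix
only at `x` and at `y`. -/
theorem jacobi_indicator (Ξ : GraphCovering T G) (b : V → ℝ) (a : E → ℝ) {x y : W}
    (h : T.Adj x y) {S : Set W} (hx : x ∈ S) (hy : y ∉ S)
    (hS : ∀ u w, T.Adj u w → u ∈ S → w ∉ S → u = x ∧ w = y) (u : VertexSpace W) :
    Ξ.jacobi b a (VertexSpace.indicator S u)
      = VertexSpace.indicator S (Ξ.jacobi b a u)
        - (Ξ.entry b a x y * u y) • lp.single 2 x (1 : ℂ)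
        + (Ξ.entry b a x y * u x) • lp.single 2 y (1 : ℂ) := by
  classical
  ext w
  have hterm : ∀ v ∈ closedNbhd T w,
      (Ξ.entry b a w v : ℂ) * VertexSpace.indicator S u v
        = (if w ∈ S then 1 else 0) * ((Ξ.entry b a w v : ℂ) * u v)
          - (if v = y then (if w = x then Ξ.entry b a x y * u y else 0) else 0)
          + (if v = x then (if w = y then Ξ.entry b a x y * u x else 0) else 0) := by
    intro v hv
    rw [VertexSpace.indicator_apply]
    have hvw : v = w ∨ T.Adj w v := mem_closedNbhd.1 hv
    by_cases hw : w ∈ S <;> by_cases hvS : v ∈ S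
    · have h1 : v ≠ y := fun e => hy (e ▸ hvS)
      have h2 : w ≠ y := fun e => hy (e ▸ hw)
      simp [hw, hvS, h1, h2]
    · have h1 : v ≠ w := fun e => hvS (e ▸ hw)
      obtain ⟨rfl, rfl⟩ := hS w v (hvw.resolve_left h1) hw hvS
      simp [hw, hvS, h.ne']
    · have h1 : v ≠ w := fun e => hw (e ▸ hvS)
      obtain ⟨rfl, rfl⟩ := hS v w (hvw.resolve_left h1).symm hvS hw
      simp [hw, hvS, h.ne, entry_comm Ξ b a w v]
    · have h1 : v ≠ x := fun e => hvS (e ▸ hx)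
      have h2 : w ≠ x := fun e => hw (e ▸ hx)
      simp [hw, hvS, h1, h2]
  rw [jacobi_apply, Finset.sum_congr rfl hterm, Finset.sum_add_distrib, Finset.sum_sub_distrib,
    ← Finset.mul_sum, ← jacobi_apply, Finset.sum_ite_eq', Finset.sum_ite_eq']
  have e1 : (if y ∈ closedNbhd T w then (if w = x then (Ξ.entry b a x y : ℂ) * u y else 0) else 0)
      = (Ξ.entry b a x y * u y) * (lp.single 2 x (1 : ℂ) : VertexSpace W) w := by
    rw [lp.single_apply, Pi.single_apply]
    by_cases hwx : w = x
    · subst hwx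
      simp [mem_closedNbhd, h]
    · simp [hwx]
  have e2 : (if x ∈ closedNbhd T w then (if w = y then (Ξ.entry b a x y : ℂ) * u x else 0) else 0)
      = (Ξ.entry b a x y * u x) * (lp.single 2 y (1 : ℂ) : VertexSpace W) w := by
    rw [lp.single_apply, Pi.single_apply]
    by_cases hwy : w = y
    · subst hwy
      simp [mem_closedNbhd, h.symm]
    · simp [hwy]
  have e3 : (if w ∈ S then (1 : ℂ) else 0) * Ξ.jacobi b a u w
      = VertexSpace.indicator S (Ξ.jacobi b a u) w := by
    rw [VertexSpace.indicator_apply]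
    by_cases hw : w ∈ S <;> simp [hw]
  rw [e1, e2, e3]
  rfl

/-- The Green's function cut off along an edge `xy` is a combination of the columns `x` and `y` of
the Green's function. -/
theorem indicator_resolvent_single (Ξ : GraphCovering T G) (b : V → ℝ) (a : E → ℝ)
    {z : ℂ} (hz : z ∈ resolventSet ℂ (Ξ.jacobi b a)) {x y : W} (h : T.Adj x y) {S : Set W}
    (hx : x ∈ S) (hy : y ∉ S) (hS : ∀ u w, T.Adj u w → u ∈ S → w ∉ S → u = x ∧ w = y) (w : W) :
    S.indicator (resolvent (Ξ.jacobi b a) z (lp.single 2 y (1 : ℂ))) w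
      = Ξ.entry b a x y * (matrixElement y y (resolvent (Ξ.jacobi b a) z)
            * matrixElement w x (resolvent (Ξ.jacobi b a) z)
          - matrixElement x y (resolvent (Ξ.jacobi b a) z)
            * matrixElement w y (resolvent (Ξ.jacobi b a) z)) := by
  set H := Ξ.jacobi b a with hH
  set R := resolvent H z with hR
  set ψ := R (lp.single 2 y (1 : ℂ)) with hψ
  have h1 : z • ψ - H ψ = lp.single 2 y (1 : ℂ) := by
    have := DFunLike.congr_fun (mul_resolvent_cancel hz) (lp.single 2 y (1 : ℂ) : VertexSpace W)
    simpa [Algebra.algebraMap_eq_smul_one] using this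
  have h2 : ∀ u : VertexSpace W, R (z • u - H u) = u := fun u => by
    have := DFunLike.congr_fun (resolvent_mul_cancel hz) u
    simpa [Algebra.algebraMap_eq_smul_one] using this
  have h3 : z • VertexSpace.indicator S ψ - H (VertexSpace.indicator S ψ)
      = (Ξ.entry b a x y * ψ y) • lp.single 2 x (1 : ℂ)
        - (Ξ.entry b a x y * ψ x) • lp.single 2 y (1 : ℂ) := by
    rw [hH, jacobi_indicator Ξ b a h hx hy hS, ← hH]
    have : z • VertexSpace.indicator S ψ - VertexSpace.indicator S (H ψ) = 0 := by
      ext w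
      have hw := congrArg (fun u : VertexSpace W => u w) h1
      change z * S.indicator ψ w - S.indicator (H ψ) w = 0
      by_cases hwS : w ∈ S
      · have hwy : w ≠ y := fun e => hy (e ▸ hwS)
        have hw' : z * ψ w - H ψ w = 0 := hw.trans (lp.single_apply_ne 2 y _ hwy)
        simpa [hwS] using hw'
      · simp [hwS]
    linear_combination (norm := module) this
  have h4 := h2 (VertexSpace.indicator S ψ)
  rw [h3, map_sub, map_smul, map_smul] at h4
  have h5 := congrArg (fun u : VertexSpace W => u w) h4
  simp only [matrixElement_apply, ← hψ]
  rw [VertexSpace.indicator_apply] at h5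
  rw [← h5]
  change Ξ.entry b a x y * ψ y * R (lp.single 2 x (1 : ℂ)) w - Ξ.entry b a x y * ψ x * ψ w = _
  ring

/-- Evaluating the column cut off along an edge at the end inside gives an algebraic relation
between the values of the Green's function at the two ends and on the edge. -/
theorem matrixElement_edge (Ξ : GraphCovering T G) (b : V → ℝ) (a : E → ℝ) (hT : T.IsAcyclic)
    {z : ℂ} (hz : z ∈ resolventSet ℂ (Ξ.jacobi b a)) {x y : W} (h : T.Adj x y) :
    Ξ.entry b a x y * (matrixElement x x (resolvent (Ξ.jacobi b a) z)
        * matrixElement y y (resolvent (Ξ.jacobi b a) z)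
      - matrixElement x y (resolvent (Ξ.jacobi b a) z) ^ 2)
      = matrixElement x y (resolvent (Ξ.jacobi b a) z) := by
  obtain ⟨S, hx, hy, hS⟩ := hT.exists_side h
  have := Ξ.indicator_resolvent_single b a hz h hx hy hS x
  rw [Set.indicator_of_mem hx, ← matrixElement_apply] at this
  linear_combination -this

/-- Evaluating the column cut off along an edge at the end outside gives the symmetry of the Green's
function between neighbours. -/
theorem matrixElement_comm (Ξ : GraphCovering T G) (b : V → ℝ) (a : E → ℝ) (hT : T.IsAcyclic)
    {z : ℂ} (hz : z ∈ resolventSet ℂ (Ξ.jacobi b a)) {x y : W} (h : T.Adj x y)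
    (ha : Ξ.entry b a x y ≠ 0) (hyy : matrixElement y y (resolvent (Ξ.jacobi b a) z) ≠ 0) :
    matrixElement y x (resolvent (Ξ.jacobi b a) z)
      = matrixElement x y (resolvent (Ξ.jacobi b a) z) := by
  obtain ⟨S, hx, hy, hS⟩ := hT.exists_side h
  have := Ξ.indicator_resolvent_single b a hz h hx hy hS y
  rw [Set.indicator_of_notMem hy] at this
  have ha' : (Ξ.entry b a x y : ℂ) ≠ 0 := by exact_mod_cast ha
  refine mul_left_cancel₀ (mul_ne_zero ha' hyy) ?_
  linear_combination -this

/-- The row at `x` of `(z - H) R = 1`, in column `x`. -/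
theorem matrixElement_row [DecidableEq V] (Ξ : GraphCovering T G) (b : V → ℝ) (a : E → ℝ)
    {z : ℂ} (hz : z ∈ resolventSet ℂ (Ξ.jacobi b a)) (x : W) :
    (z - b (Ξ.onVert x)) * matrixElement x x (resolvent (Ξ.jacobi b a) z)
      - ∑ e : E × Bool with G.source e = Ξ.onVert x,
          a e.1 * matrixElement (Ξ.liftEnd x e) x (resolvent (Ξ.jacobi b a) z) = 1 := by
  have h := DFunLike.congr_fun (mul_resolvent_cancel hz) (lp.single 2 x (1 : ℂ) : VertexSpace W)
  have h1 := congrArg (fun u : VertexSpace W => u x) h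
  have h2 : z * resolvent (Ξ.jacobi b a) z (lp.single 2 x (1 : ℂ)) x
      - Ξ.jacobi b a (resolvent (Ξ.jacobi b a) z (lp.single 2 x (1 : ℂ))) x = 1 := by
    refine Eq.trans ?_ (h1.trans (lp.single_apply_self 2 x _))
    simp [Algebra.algebraMap_eq_smul_one]
    rfl
  rw [jacobi_apply_eq_sum_darts] at h2
  simp only [matrixElement_apply]
  linear_combination h2

end GraphCovering

/-! ### Spectral measures and the resolvent -/

section SpectralMeasure

open MeasureTheory
open scoped CompactlySupported

variable {𝓗 : Type*} [NormedAddCommGroup 𝓗] [InnerProductSpace ℂ 𝓗] [CompleteSpace 𝓗]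

theorem spectralFunctional_apply (H : 𝓗 →L[ℂ] 𝓗) (v : 𝓗) (f : C_c(ℝ, ℝ)) :
    spectralFunctional H v f = (inner ℂ v (cfc (fun t : ℝ => f t) H v)).re := rfl

theorem spectralFunctional_congr {H : 𝓗 →L[ℂ] 𝓗} (v : 𝓗) {f : C_c(ℝ, ℝ)} {g : ℝ → ℝ}
    (h : Set.EqOn f g (spectrum ℝ H)) :
    spectralFunctional H v f = (inner ℂ v (cfc g H v)).re := by
  rw [spectralFunctional_apply, cfc_congr h]

theorem spectralMeasure_compl_spectrum (H : 𝓗 →L[ℂ] 𝓗) (v : 𝓗) :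
    spectralMeasure H v (spectrum ℝ H)ᶜ = 0 := by
  have hc : IsClosed (spectrum ℝ H) := spectrum.isClosed H
  have hreg : (spectralMeasure H v).Regular := by unfold spectralMeasure; infer_instance
  rw [hc.isOpen_compl.measure_eq_iSup_isCompact]
  simp only [ENNReal.iSup_eq_zero]
  intro K hKU hK
  obtain ⟨f, hf1, hf0, hfc, hf⟩ := exists_continuous_one_zero_of_isCompact hK hc
    (Set.disjoint_left.2 fun _ hx => hKU hx)
  have h := RealRMK.rieszMeasure_le_of_eq_one (spectralFunctional H v) (f := ⟨f, hfc⟩)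
    (fun x => (hf x).1) hK hf1
  rw [spectralFunctional_congr v (g := fun _ => 0) hf0, cfc_const_zero] at h
  simpa [spectralMeasure] using h

/-- Functions of `H` depend only on the values on the compact spectrum, where a continuous function
agrees with one of compact support on the line. -/
theorem exists_cc_eq_on_spectrum (H : 𝓗 →L[ℂ] 𝓗) {f : ℝ → ℝ} (hf : ContinuousOn f (spectrum ℝ H)) :
    ∃ g : C_c(ℝ, ℝ), Set.EqOn g f (spectrum ℝ H) := by
  obtain ⟨F, hF⟩ := ContinuousMap.exists_restrict_eq (spectrum.isClosed H)
    ⟨(spectrum ℝ H).domRestrict f, hf.domRestrict⟩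
  obtain ⟨χ, hχ, -, hχc, -⟩ := exists_continuous_one_zero_of_isCompact (spectrum.isCompact H)
    isClosed_empty (Set.disjoint_empty (spectrum ℝ H))
  refine ⟨⟨χ * F, hχc.mul_right⟩, fun t ht => ?_⟩
  have h1 : F t = f t := DFunLike.congr_fun hF ⟨t, ht⟩
  change χ t * F t = f t
  rw [hχ ht, h1, Pi.one_apply, one_mul]

instance isFiniteMeasure_spectralMeasure (H : 𝓗 →L[ℂ] 𝓗) (v : 𝓗) :
    IsFiniteMeasure (spectralMeasure H v) := by
  refine ⟨?_⟩
  have h : IsFiniteMeasureOnCompacts (spectralMeasure H v) := by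
    unfold spectralMeasure; infer_instance
  rw [← measure_add_measure_compl (spectrum.isClosed H).measurableSet,
    spectralMeasure_compl_spectrum, add_zero]
  exact (spectrum.isCompact H).measure_lt_top

theorem ae_mem_spectrum (H : 𝓗 →L[ℂ] 𝓗) (v : 𝓗) :
    ∀ᵐ t ∂spectralMeasure H v, t ∈ spectrum ℝ H :=
  spectralMeasure_compl_spectrum H v

theorem integral_spectralMeasure (H : 𝓗 →L[ℂ] 𝓗) (v : 𝓗) {f : ℝ → ℝ}
    (hf : ContinuousOn f (spectrum ℝ H)) :
    ∫ t, f t ∂spectralMeasure H v = (inner ℂ v (cfc f H v)).re := by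
  obtain ⟨g, hg⟩ := exists_cc_eq_on_spectrum H hf
  rw [← spectralFunctional_congr v hg, ← RealRMK.integral_rieszMeasure]
  refine integral_congr_ae ?_
  filter_upwards [ae_mem_spectrum H v] with t ht using (hg ht).symm

theorem integrable_spectralMeasure (H : 𝓗 →L[ℂ] 𝓗) (v : 𝓗) {F : Type*} [NormedAddCommGroup F]
    [SecondCountableTopology F] {f : ℝ → F}
    (hf : ContinuousOn f (spectrum ℝ H)) : Integrable f (spectralMeasure H v) := by
  have h := hf.integrableOn_compact (μ := spectralMeasure H v) (spectrum.isCompact H)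
  rwa [IntegrableOn, Measure.restrict_eq_self_of_ae_mem (ae_mem_spectrum H v)] at h

theorem spectralMeasure_real_univ {H : 𝓗 →L[ℂ] 𝓗} (hH : IsSelfAdjoint H) (v : 𝓗) :
    (spectralMeasure H v).real Set.univ = ‖v‖ ^ 2 := by
  have h := integral_spectralMeasure H v (f := fun _ => 1) continuousOn_const
  rw [cfc_const_one ℝ H] at h
  simpa [inner_self_eq_norm_sq_to_K, ← Complex.ofReal_pow] using h

/-- Vectors related by an isometry that commutes with `H` have the same spectral measure. -/
theorem spectralMeasure_map_isometry {H : 𝓗 →L[ℂ] 𝓗} (U : 𝓗 →ₗᵢ[ℂ] 𝓗)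
    (hU : Commute H U.toContinuousLinearMap) (v : 𝓗) :
    spectralMeasure H (U v) = spectralMeasure H v := by
  have : spectralFunctional H (U v) = spectralFunctional H v := by
    ext f
    have h1 := DFunLike.congr_fun (hU.cfc_real (fun t => f t)).eq v
    change cfc (fun t : ℝ => f t) H (U v) = U (cfc (fun t : ℝ => f t) H v) at h1
    rw [spectralFunctional_apply, spectralFunctional_apply, h1, U.inner_map_map]
  rw [spectralMeasure, spectralMeasure, this]

omit [CompleteSpace 𝓗] in
theorem sub_ne_zero_of_mem_spectrum {H : 𝓗 →L[ℂ] 𝓗} {z : ℂ}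
    (hz : z.im ≠ 0 ∨ z.re ∉ spectrum ℝ H) {t : ℝ} (ht : t ∈ spectrum ℝ H) : z - t ≠ 0 := by
  intro h
  rcases hz with hz | hz
  · exact hz (by simpa using congrArg Complex.im h)
  · refine hz ?_
    have : z.re - t = 0 := by simpa using congrArg Complex.re h
    rwa [sub_eq_zero.1 this]

omit [CompleteSpace 𝓗] in
theorem continuousOn_inv_sub {H : 𝓗 →L[ℂ] 𝓗} {z : ℂ}
    (hz : z.im ≠ 0 ∨ z.re ∉ spectrum ℝ H) :
    ContinuousOn (fun t : ℝ => (z - t)⁻¹) (spectrum ℝ H) :=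
  ContinuousOn.inv₀ (by fun_prop) fun _ ht => sub_ne_zero_of_mem_spectrum hz ht

theorem cfc_const_sub {H : 𝓗 →L[ℂ] 𝓗} (hH : IsSelfAdjoint H) (x : ℝ) :
    cfc (fun t : ℝ => x - t) H = x • (1 : 𝓗 →L[ℂ] 𝓗) - H := by
  rw [cfc_sub (fun _ => x) (fun t => t) H continuousOn_const continuousOn_id, cfc_const x H,
    cfc_id' ℝ H, Algebra.algebraMap_eq_smul_one]

theorem cfc_mul_sub_smul_cfc {H : 𝓗 →L[ℂ] 𝓗} {f g h : ℝ → ℝ}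
    (hf : ContinuousOn f (spectrum ℝ H)) (hg : ContinuousOn g (spectrum ℝ H))
    (hh : ContinuousOn h (spectrum ℝ H)) (c : ℝ) :
    cfc f H * cfc g H - c • cfc h H = cfc (fun t => f t * g t - c * h t) H := by
  rw [cfc_sub (fun t => f t * g t) (fun t => c * h t) H (hf.mul hg) (continuousOn_const.mul hh),
    cfc_mul f g H hf hg, cfc_const_mul c h H hh]

omit [CompleteSpace 𝓗] in
theorem resolvent_eq_of_mul_eq {A B D H : 𝓗 →L[ℂ] 𝓗} {z : ℂ}
    (hD : D = z.re • (1 : 𝓗 →L[ℂ] 𝓗) - H) (hAD : Commute A D) (hBD : Commute B D)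
    (e1 : D * A - z.im • B = 1) (e2 : D * B + z.im • A = 0) :
    z ∈ resolventSet ℂ H ∧ resolvent H z = A + Complex.I • B := by
  have hzD : algebraMap ℂ (𝓗 →L[ℂ] 𝓗) z - H = D + (Complex.I * z.im) • (1 : 𝓗 →L[ℂ] 𝓗) := by
    rw [hD, Algebra.algebraMap_eq_smul_one]
    conv_lhs => rw [← Complex.re_add_im z]
    rw [add_smul, mul_comm Complex.I, Complex.coe_smul]
    abel
  have hl : (D + (Complex.I * z.im) • (1 : 𝓗 →L[ℂ] 𝓗)) * (A + Complex.I • B) = 1 := by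
    have : (D + (Complex.I * z.im) • (1 : 𝓗 →L[ℂ] 𝓗)) * (A + Complex.I • B)
        = (D * A - z.im • B) + Complex.I • (D * B + z.im • A) := by
      have hI : Complex.I * (z.im : ℂ) * Complex.I = -z.im := by
        linear_combination (z.im : ℂ) * Complex.I_mul_I
      rw [add_mul, mul_add, mul_smul_comm, smul_mul_assoc, one_mul, smul_add, smul_add, smul_smul,
        hI, neg_smul, Complex.coe_smul, ← Complex.coe_smul z.im A, smul_smul]
      abel
    rw [this, e1, e2, smul_zero, add_zero]
  have hr : (A + Complex.I • B) * (D + (Complex.I * z.im) • (1 : 𝓗 →L[ℂ] 𝓗)) = 1 := by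
    refine Eq.trans ?_ hl
    exact (Commute.add_right (hAD.add_left (hBD.smul_left Complex.I))
      ((Commute.one_right _).smul_right (Complex.I * (z.im : ℂ)))).eq
  have hu : IsUnit (algebraMap ℂ (𝓗 →L[ℂ] 𝓗) z - H) := hzD ▸ ⟨⟨_, _, hl, hr⟩, rfl⟩
  refine ⟨hu, ?_⟩
  rw [resolvent, ← one_mul (Ring.inverse _), ← hr, ← hzD, Ring.mul_inverse_cancel_right _ _ hu]

/-- For `z` off the spectrum, the real and imaginary parts of `t ↦ (z - t)⁻¹` give the resolvent
through the real functional calculus. -/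
theorem resolvent_eq_cfc {H : 𝓗 →L[ℂ] 𝓗} (hH : IsSelfAdjoint H) {z : ℂ}
    (hz : z.im ≠ 0 ∨ z.re ∉ spectrum ℝ H) :
    z ∈ resolventSet ℂ H ∧ resolvent H z = cfc (fun t : ℝ => ((z - t)⁻¹).re) H
      + Complex.I • cfc (fun t : ℝ => ((z - t)⁻¹).im) H := by
  have hc := continuousOn_inv_sub hz
  have hre : ContinuousOn (fun t : ℝ => ((z - t)⁻¹).re) (spectrum ℝ H) :=
    Complex.continuous_re.comp_continuousOn hc
  have him : ContinuousOn (fun t : ℝ => ((z - t)⁻¹).im) (spectrum ℝ H) :=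
    Complex.continuous_im.comp_continuousOn hc
  have hrel : ∀ t ∈ spectrum ℝ H,
      (z.re - t) * ((z - t)⁻¹).re - z.im * ((z - t)⁻¹).im = 1 ∧
      (z.re - t) * ((z - t)⁻¹).im + z.im * ((z - t)⁻¹).re = 0 := fun t ht => by
    have h := mul_inv_cancel₀ (sub_ne_zero_of_mem_spectrum hz ht)
    constructor
    · simpa [-Complex.inv_re, -Complex.inv_im] using congrArg Complex.re h
    · simpa [-Complex.inv_re, -Complex.inv_im] using congrArg Complex.im h
  have hd : ContinuousOn (fun t : ℝ => z.re - t) (spectrum ℝ H) := by fun_prop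
  refine resolvent_eq_of_mul_eq (cfc_const_sub hH z.re) (cfc_commute_cfc _ _ H)
    (cfc_commute_cfc _ _ H) ?_ ?_
  · rw [cfc_mul_sub_smul_cfc hd hre him, ← cfc_const_one ℝ H]
    exact cfc_congr fun t ht => (hrel t ht).1
  · rw [← sub_neg_eq_add, ← neg_smul, cfc_mul_sub_smul_cfc hd him hre, ← cfc_const_zero ℝ H]
    exact cfc_congr fun t ht => (by linarith [(hrel t ht).2] :
      (z.re - t) * ((z - t)⁻¹).im - -z.im * ((z - t)⁻¹).re = 0)

theorem inner_cfc_eq_re {H : 𝓗 →L[ℂ] 𝓗} (f : ℝ → ℝ) (v : 𝓗) :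
    inner ℂ v (cfc f H v) = ((inner ℂ v (cfc f H v)).re : ℂ) := by
  have hs : IsSelfAdjoint (cfc f H) := cfc_predicate f H
  refine (Complex.conj_eq_iff_re.1 ?_).symm
  rw [inner_conj_symm]
  exact ContinuousLinearMap.isSelfAdjoint_iff_isSymmetric.1 hs v v

theorem inner_resolvent {H : 𝓗 →L[ℂ] 𝓗} (hH : IsSelfAdjoint H) (v : 𝓗) {z : ℂ}
    (hz : z.im ≠ 0 ∨ z.re ∉ spectrum ℝ H) :
    inner ℂ v (resolvent H z v) = ∫ t : ℝ, (z - t)⁻¹ ∂spectralMeasure H v := by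
  have hc := continuousOn_inv_sub hz
  rw [← integral_re_add_im (integrable_spectralMeasure H v hc)]
  have h1 := integral_spectralMeasure H v (Complex.continuous_re.comp_continuousOn hc)
  have h2 := integral_spectralMeasure H v (Complex.continuous_im.comp_continuousOn hc)
  simp only [Function.comp_def] at h1 h2
  simp only [RCLike.re_eq_complex_re, RCLike.im_eq_complex_im]
  rw [h1, h2, (resolvent_eq_cfc hH hz).2]
  change inner ℂ v (cfc _ H v + Complex.I • cfc _ H v) = _
  rw [inner_add_right, inner_smul_right, mul_comm Complex.I]
  exact congrArg₂ (· + · * Complex.I) (inner_cfc_eq_re _ v) (inner_cfc_eq_re _ v)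

/-- If the spectral measures at a family of vectors that separates operators vanish on an open set,
then this set does not meet the spectrum. -/
theorem notMem_spectrum_of_spectralMeasure_eq_zero {H : 𝓗 →L[ℂ] 𝓗} (hH : IsSelfAdjoint H)
    {ι : Type*} (e : ι → 𝓗) (he : ∀ A : 𝓗 →L[ℂ] 𝓗, (∀ i, A (e i) = 0) → A = 0)
    {O : Set ℝ} (hO : IsOpen O) (h0 : ∀ i, spectralMeasure H (e i) O = 0) {α : ℝ} (hα : α ∈ O) :
    α ∉ spectrum ℝ H := by
  intro hαs
  obtain ⟨g, hg1, hg0, -, -⟩ :=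
    exists_continuous_one_zero_of_isCompact (isCompact_singleton (x := α)) hO.isClosed_compl
      (Set.disjoint_left.2 fun x hx hx' => hx' (hx ▸ hα))
  have hgc : ContinuousOn g (spectrum ℝ H) := g.continuous.continuousOn
  have hsa : IsSelfAdjoint (cfc g H) := cfc_predicate g H
  have hz : cfc g H = 0 := he _ fun i => by
    have h1 : ∫ t, g t * g t ∂spectralMeasure H (e i) = 0 := by
      refine (integral_congr_ae (g := fun _ => (0 : ℝ)) ?_).trans (by simp)
      have : ∀ᵐ t ∂spectralMeasure H (e i), t ∉ O := measure_eq_zero_iff_ae_notMem.1 (h0 i)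
      filter_upwards [this] with t ht
      simp [hg0 ht]
    rw [integral_spectralMeasure H (e i) (f := fun t => g t * g t) (hgc.mul hgc),
      cfc_mul g g H hgc hgc] at h1
    have h2 : inner ℂ (e i) ((cfc g H * cfc g H) (e i)) = inner ℂ (cfc g H (e i)) (cfc g H (e i)) :=
      (ContinuousLinearMap.isSelfAdjoint_iff_isSymmetric.1 hsa (e i) _).symm
    rw [h2, inner_self_eq_norm_sq_to_K] at h1
    have h3 : ‖cfc g H (e i)‖ ^ 2 = 0 := by
      rw [← h1]
      norm_cast
    exact norm_eq_zero.1 (by simpa using h3)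
  have h4 : Set.EqOn g (fun _ => 0) (spectrum ℝ H) := by
    rw [← cfc_eq_cfc_iff_eqOn (a := H), hz, cfc_const_zero]
  have h5 : g α = 0 := h4 hαs
  rw [hg1 rfl] at h5
  exact one_ne_zero h5

end SpectralMeasure

/-! ### The phase along a vertical line -/

section EdgeRelations

/-- The logarithmic derivative of `∏ (1 + a η) / ∏ ρ` along solutions of the vertex and edge
relations. Differentiating the vertex relation expresses `c ρ` at each vertex by logarithmic
derivatives; in the sum over the vertices, each edge collects the terms of its two directions, and
the edge relation turns these into the logarithmic derivative of `1 + a η`. -/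
theorem sum_logDeriv_eq {V E : Type*} [Fintype V] [Fintype E] [DecidableEq V] (G : Multigraph V E)
    {a : E → ℂ} {β : V → ℂ} {c : ℂ} {ρ ρ' : V → ℂ} {η η' : E × Bool → ℂ}
    (ha : ∀ e, a e ≠ 0) (hρ : ∀ v, ρ v ≠ 0)
    (h1 : ∀ v, β v * ρ v - ∑ d : E × Bool with G.source d = v, a d.1 * η d = 1)
    (h1' : ∀ v, c * ρ v + β v * ρ' v - ∑ d : E × Bool with G.source d = v, a d.1 * η' d = 0)
    (h2 : ∀ d : E × Bool, a d.1 * (ρ (G.source d) * ρ (G.target d) - η d ^ 2) = η d)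
    (h2' : ∀ d : E × Bool, a d.1 * (ρ' (G.source d) * ρ (G.target d)
      + ρ (G.source d) * ρ' (G.target d) - 2 * η d * η' d) = η' d)
    (hs : ∀ e, η (e, false) = η (e, true)) (hs' : ∀ e, η' (e, false) = η' (e, true)) :
    (∀ e, 1 + a e * η (e, true) ≠ 0) ∧
    ∑ e, a e * η' (e, true) / (1 + a e * η (e, true)) - ∑ v, ρ' v / ρ v = c * ∑ v, ρ v := by
  have hne : ∀ d : E × Bool, (1 + a d.1 * η d) * η d ≠ 0 := fun d => by
    have : (1 + a d.1 * η d) * η d = a d.1 * (ρ (G.source d) * ρ (G.target d)) := by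
      linear_combination -h2 d
    rw [this]
    exact mul_ne_zero (ha _) (mul_ne_zero (hρ _) (hρ _))
  refine ⟨fun e => left_ne_zero_of_mul (hne (e, true)), ?_⟩
  have hv : ∀ v, c * ρ v = -(ρ' v / ρ v)
      + ∑ d : E × Bool with G.source d = v,
        (a d.1 * η' d - a d.1 * η d * (ρ' (G.source d) / ρ (G.source d))) := by
    intro v
    have e1 : ∑ d : E × Bool with G.source d = v,
        (a d.1 * η' d - a d.1 * η d * (ρ' (G.source d) / ρ (G.source d)))
        = ∑ d : E × Bool with G.source d = v, a d.1 * η' d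
          - (∑ d : E × Bool with G.source d = v, a d.1 * η d) * (ρ' v / ρ v) := by
      rw [Finset.sum_mul, ← Finset.sum_sub_distrib]
      refine Finset.sum_congr rfl fun d hd => ?_
      rw [(Finset.mem_filter.1 hd).2]
    have e2 : ρ v * (ρ' v / ρ v) = ρ' v := mul_div_cancel₀ _ (hρ v)
    rw [e1]
    linear_combination h1' v - (ρ' v / ρ v) * h1 v + β v * e2
  have he : ∀ e, (a e * η' (e, true)
        - a e * η (e, true) * (ρ' (G.source (e, true)) / ρ (G.source (e, true))))
      + (a e * η' (e, false)
        - a e * η (e, false) * (ρ' (G.source (e, false)) / ρ (G.source (e, false))))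
      = a e * η' (e, true) / (1 + a e * η (e, true)) := by
    intro e
    have h3 := h2 (e, true)
    have h3' := h2' (e, true)
    have h4 := hne (e, true)
    have ht : G.target (e, true) = G.source (e, false) := rfl
    rw [hs, hs']
    rw [ht] at h3 h3'
    have hx := hρ (G.source (e, true))
    have hy := hρ (G.source (e, false))
    simp only at h3 h3' h4
    set x := ρ (G.source (e, true))
    set y := ρ (G.source (e, false))
    set x' := ρ' (G.source (e, true))
    set y' := ρ' (G.source (e, false))
    set n := η (e, true)
    set n' := η' (e, true)
    have hn1 : 1 + a e * n ≠ 0 := left_ne_zero_of_mul h4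
    have hn : n ≠ 0 := right_ne_zero_of_mul h4
    have hae := ha e
    have hxy : a e * (x * y) = n * (1 + a e * n) := by linear_combination h3
    have hxy' : a e * (x' * y + x * y') = n' * (1 + 2 * a e * n) := by linear_combination h3'
    have hL : x' / x + y' / y = n' * (1 + 2 * a e * n) / (n * (1 + a e * n)) := by
      rw [← hxy, ← hxy']
      field_simp
    have : a e * n' - a e * n * (x' / x) + (a e * n' - a e * n * (y' / y))
        = 2 * a e * n' - a e * n * (x' / x + y' / y) := by ring
    rw [this, hL]
    field_simp
    ring
  rw [Finset.mul_sum, Finset.sum_congr rfl fun v _ => hv v, Finset.sum_add_distrib,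
    Finset.sum_fiberwise (s := Finset.univ) (g := fun d : E × Bool => G.source d)
      (f := fun d => a d.1 * η' d - a d.1 * η d * (ρ' (G.source d) / ρ (G.source d))),
    Fintype.sum_prod_type]
  simp only [Fintype.sum_bool, he, Finset.sum_neg_distrib]
  ring

end EdgeRelations

section Phase

open MeasureTheory Filter Topology

/-- The Stieltjes transform of `μ` at the point `t₀ + i y` of the vertical line through `t₀`, with
the sign convention of `(z - H)⁻¹`. -/
def stieltjesLine (μ : Measure ℝ) (t₀ y : ℝ) : ℂ := ∫ t : ℝ, ((t₀ + y * Complex.I : ℂ) - t)⁻¹ ∂μ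

/-- The average over `μ` of the phase that the factor `t₀ + i s - t` acquires as `s` goes from `0`
to `y`. The quotient is `0` at `t = t₀`, which is harmless for measures with no mass near `t₀`. -/
def phaseLine (μ : Measure ℝ) (t₀ y : ℝ) : ℝ := ∫ t : ℝ, Real.arctan (y / (t₀ - t)) ∂μ

theorem norm_line_sub_ge {t₀ y t : ℝ} : |t₀ - t| ≤ ‖((t₀ + y * Complex.I : ℂ) - t)‖ := by
  have h := Complex.abs_re_le_norm ((t₀ + y * Complex.I : ℂ) - t)
  simpa using h

variable {μ : Measure ℝ} [IsFiniteMeasure μ] {t₀ δ : ℝ}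

theorem integrable_inv_line_sub (hδ : 0 < δ) (hμ : ∀ᵐ t ∂μ, δ ≤ |t₀ - t|) (y : ℝ) :
    Integrable (fun t : ℝ => ((t₀ + y * Complex.I : ℂ) - t)⁻¹) μ := by
  refine Integrable.of_bound (by fun_prop) δ⁻¹ ?_
  filter_upwards [hμ] with t ht
  rw [norm_inv]
  exact inv_anti₀ hδ (ht.trans norm_line_sub_ge)

theorem re_inv_line_sub (t₀ y t : ℝ) :
    (((t₀ + y * Complex.I : ℂ) - t)⁻¹).re = (t₀ - t) / ((t₀ - t) ^ 2 + y ^ 2) := by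
  simp [Complex.inv_re, Complex.normSq_apply, sq]

theorem re_stieltjesLine (hδ : 0 < δ) (hμ : ∀ᵐ t ∂μ, δ ≤ |t₀ - t|) (y : ℝ) :
    (stieltjesLine μ t₀ y).re = ∫ t, (t₀ - t) / ((t₀ - t) ^ 2 + y ^ 2) ∂μ := by
  have h := integral_re (integrable_inv_line_sub hδ hμ y)
  simp only [RCLike.re_eq_complex_re, re_inv_line_sub] at h
  exact h.symm

omit [IsFiniteMeasure μ] in
theorem stieltjesLine_neg (y : ℝ) :
    stieltjesLine μ t₀ (-y) = starRingEnd ℂ (stieltjesLine μ t₀ y) := by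
  rw [stieltjesLine, stieltjesLine, ← integral_conj]
  refine integral_congr_ae (.of_forall fun t => ?_)
  simp

/-- The phase is a primitive of the real part of the Stieltjes transform along the line. -/
theorem hasDerivAt_phaseLine (hδ : 0 < δ) (hμ : ∀ᵐ t ∂μ, δ ≤ |t₀ - t|) (y : ℝ) :
    HasDerivAt (phaseLine μ t₀) (stieltjesLine μ t₀ y).re y := by
  rw [re_stieltjesLine hδ hμ]
  refine (hasDerivAt_integral_of_dominated_loc_of_deriv_le
    (F := fun y t => Real.arctan (y / (t₀ - t)))
    (F' := fun y t => (t₀ - t) / ((t₀ - t) ^ 2 + y ^ 2))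
    (bound := fun _ => δ⁻¹) (s := Set.univ) Filter.univ_mem ?_ ?_ ?_ ?_ ?_ ?_).2
  · exact .of_forall fun y => (Real.measurable_arctan.comp (by fun_prop)).aestronglyMeasurable
  · refine Integrable.of_bound (Real.measurable_arctan.comp (by fun_prop)).aestronglyMeasurable
      (Real.pi / 2) (.of_forall fun t => ?_)
    exact (abs_le.2 ⟨(Real.neg_pi_div_two_lt_arctan _).le, (Real.arctan_lt_pi_div_two _).le⟩)
  · exact Measurable.aestronglyMeasurable (by fun_prop)
  · filter_upwards [hμ] with t ht y _
    rw [← re_inv_line_sub]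
    refine (Complex.abs_re_le_norm _).trans ?_
    rw [norm_inv]
    exact inv_anti₀ hδ (ht.trans norm_line_sub_ge)
  · exact integrable_const _
  · filter_upwards [hμ] with t ht y _
    have hc : t₀ - t ≠ 0 := abs_pos.1 (hδ.trans_le ht)
    refine ((hasDerivAt_id y).div_const (t₀ - t)).arctan.congr_deriv ?_
    have : (t₀ - t) ^ 2 + y ^ 2 ≠ 0 := by positivity
    simp only [id]
    field_simp

theorem tendsto_phaseLine (hδ : 0 < δ) (hμ : ∀ᵐ t ∂μ, δ ≤ |t₀ - t|) (h1 : μ.real Set.univ = 1) :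
    Tendsto (phaseLine μ t₀) atTop (𝓝 (Real.pi / 2 * (2 * μ.real (Set.Iio t₀) - 1))) := by
  have hlim : ∫ t, (Real.pi * (Set.Iio t₀).indicator (fun _ => (1 : ℝ)) t - Real.pi / 2) ∂μ
      = Real.pi / 2 * (2 * μ.real (Set.Iio t₀) - 1) := by
    rw [integral_sub (((integrable_const _).indicator measurableSet_Iio).const_mul _)
      (integrable_const _), integral_const_mul, integral_indicator_const _ measurableSet_Iio,
      integral_const, h1]
    simp
    ring
  rw [← hlim]
  refine tendsto_integral_filter_of_dominated_convergence (fun _ => Real.pi / 2) ?_ ?_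
    (integrable_const _) ?_
  · exact .of_forall fun y => (Real.measurable_arctan.comp (by fun_prop)).aestronglyMeasurable
  · exact .of_forall fun y => .of_forall fun t =>
      (abs_le.2 ⟨(Real.neg_pi_div_two_lt_arctan _).le, (Real.arctan_lt_pi_div_two _).le⟩)
  · filter_upwards [hμ] with t ht
    have hc : t₀ - t ≠ 0 := abs_pos.1 (hδ.trans_le ht)
    rcases lt_or_gt_of_ne hc with h | h
    · have ht' : t ∉ Set.Iio t₀ := by simp; linarith
      rw [Set.indicator_of_notMem ht', mul_zero, zero_sub]
      exact (Real.tendsto_arctan_atBot.mono_right nhdsWithin_le_nhds).comp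
        (tendsto_id.atTop_div_const_of_neg h)
    · have ht' : t ∈ Set.Iio t₀ := by simp; linarith
      rw [Set.indicator_of_mem ht', mul_one, sub_half]
      exact (Real.tendsto_arctan_atTop.mono_right nhdsWithin_le_nhds).comp
        (tendsto_id.atTop_div_const h)

theorem im_inv_line_sub (t₀ y t : ℝ) :
    (((t₀ + y * Complex.I : ℂ) - t)⁻¹).im = -(y / ((t₀ - t) ^ 2 + y ^ 2)) := by
  simp [Complex.inv_im, Complex.normSq_apply, sq, neg_div]

theorem stieltjesLine_ne_zero (hδ : 0 < δ) (hμ : ∀ᵐ t ∂μ, δ ≤ |t₀ - t|)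
    (h1 : μ.real Set.univ = 1) {y : ℝ} (hy : y ≠ 0) : stieltjesLine μ t₀ y ≠ 0 := by
  intro h0
  have hi := integrable_inv_line_sub hδ hμ y
  have h := integral_im hi
  simp only [RCLike.im_eq_complex_im, im_inv_line_sub] at h
  have h2 : ∫ t, ((t₀ - t) ^ 2 + y ^ 2)⁻¹ ∂μ = 0 := by
    have h3 : (stieltjesLine μ t₀ y).im = -y * ∫ t, ((t₀ - t) ^ 2 + y ^ 2)⁻¹ ∂μ := by
      rw [← integral_const_mul]
      refine h.symm.trans (integral_congr_ae (.of_forall fun t => ?_))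
      simp only [div_eq_mul_inv, neg_mul]
    rw [h0] at h3
    simpa [hy] using h3.symm
  rw [integral_eq_zero_iff_of_nonneg (fun t => by positivity)] at h2
  · have hμ0 : μ = 0 := by
      rw [← ae_eq_bot, ← Filter.empty_mem_iff_bot]
      filter_upwards [h2] with t ht
      have : 0 < ((t₀ - t) ^ 2 + y ^ 2)⁻¹ := by positivity
      exact this.ne' ht
    simp [hμ0] at h1
  · have := hi.im.const_mul (-y⁻¹)
    refine this.congr (.of_forall fun t => ?_)
    simp only [RCLike.im_eq_complex_im, im_inv_line_sub]
    field_simp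

omit [IsFiniteMeasure μ] in
theorem phaseLine_zero : phaseLine μ t₀ 0 = 0 := by simp [phaseLine]

end Phase

theorem HasDerivAt.finset_prod_logDeriv {ι : Type*} [Fintype ι] {f : ι → ℝ → ℂ} {f' : ι → ℂ} {y : ℝ}
    (hf : ∀ i, HasDerivAt (f i) (f' i) y) (h0 : ∀ i, f i y ≠ 0) :
    HasDerivAt (fun y => ∏ i, f i y) ((∏ i, f i y) * ∑ i, f' i / f i y) y := by
  classical
  refine (HasDerivAt.fun_finsetProd fun i _ => hf i).congr_deriv ?_
  rw [Finset.mul_sum]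
  refine Finset.sum_congr rfl fun i hi => ?_
  rw [← Finset.mul_prod_erase _ _ hi, smul_eq_mul]
  have := h0 i
  field_simp

section Integrality

open MeasureTheory Filter Topology

/-- The analytic core of gap labelling. Suppose that Stieltjes transforms `ρ v` of probability
measures with no mass near `t₀`, together with edge functions `η`, satisfy the vertex and edge
relations on the line through `t₀`. Then the total mass to the left of `t₀` is an integer: the
function `Φ = ∏ (1 + a η) / ∏ ρ` has logarithmic derivative `i ∑ ρ` along the line, so the phase of
`Φ` changes by `π (2 N - p)` from `-i ∞` to `i ∞`, while its asymptotics fix that change modulo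
`2 π`. -/
theorem exists_int_sum_measureReal_Iio {V E : Type*} [Fintype V] [Fintype E] [DecidableEq V]
    (G : Multigraph V E) {a : E → ℂ} (ha : ∀ e, a e ≠ 0) (b : V → ℂ) {μ : V → Measure ℝ}
    [∀ v, IsFiniteMeasure (μ v)] (hμ1 : ∀ v, (μ v).real Set.univ = 1) {t₀ δ : ℝ} (hδ : 0 < δ)
    (hμ : ∀ v, ∀ᵐ t ∂μ v, δ ≤ |t₀ - t|) {η : E × Bool → ℝ → ℂ}
    (h0 : ∀ v, stieltjesLine (μ v) t₀ 0 ≠ 0)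
    (hρd : ∀ v y, DifferentiableAt ℝ (stieltjesLine (μ v) t₀) y)
    (hηd : ∀ d y, DifferentiableAt ℝ (η d) y)
    (h1 : ∀ v (y : ℝ), ((t₀ + y * Complex.I : ℂ) - b v) * stieltjesLine (μ v) t₀ y
      - ∑ d : E × Bool with G.source d = v, a d.1 * η d y = 1)
    (h2 : ∀ (d : E × Bool) (y : ℝ), a d.1 * (stieltjesLine (μ (G.source d)) t₀ y
      * stieltjesLine (μ (G.target d)) t₀ y - η d y ^ 2) = η d y)
    (hs : ∀ e y, η (e, false) y = η (e, true) y)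
    (hη : ∀ d, Tendsto (η d) (Bornology.cobounded ℝ) (𝓝 0))
    (hρ : ∀ v, Tendsto (fun y : ℝ => y * Complex.I * stieltjesLine (μ v) t₀ y)
      (Bornology.cobounded ℝ) (𝓝 1)) :
    ∃ N : ℤ, ∑ v, (μ v).real (Set.Iio t₀) = N := by
  set ρ : V → ℝ → ℂ := fun v => stieltjesLine (μ v) t₀ with hρdef
  have hρ0 : ∀ v y, ρ v y ≠ 0 := fun v y => by
    by_cases hy : y = 0
    · rw [hy]
      exact h0 v
    · exact stieltjesLine_ne_zero hδ (hμ v) (hμ1 v) hy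
  have key : ∀ y, (∀ e, 1 + a e * η (e, true) y ≠ 0) ∧
      ∑ e, a e * deriv (η (e, true)) y / (1 + a e * η (e, true) y) - ∑ v, deriv (ρ v) y / ρ v y
        = Complex.I * ∑ v, ρ v y := by
    intro y
    refine sum_logDeriv_eq G (β := fun v => (t₀ + y * Complex.I : ℂ) - b v) (ρ := fun v => ρ v y)
      (ρ' := fun v => deriv (ρ v) y) (η := fun d => η d y) (η' := fun d => deriv (η d) y) ha
      (fun v => hρ0 v y) (fun v => h1 v y) (fun v => ?_) (fun d => h2 d y) (fun d => ?_)
      (fun e => hs e y) (fun e => ?_)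
    · have hz : HasDerivAt (fun y : ℝ => (t₀ + y * Complex.I : ℂ) - b v) Complex.I y := by
        have := (((hasDerivAt_id y).ofReal_comp.mul_const Complex.I).const_add (t₀ : ℂ)).sub_const
          (b v)
        simpa using this
      have hsum := HasDerivAt.fun_sum (u := Finset.univ.filter fun d : E × Bool => G.source d = v)
        fun d _ => (hηd d y).hasDerivAt.const_mul (a d.1)
      have := (hz.mul (hρd v y).hasDerivAt).sub hsum
      exact this.unique ((hasDerivAt_const y (1 : ℂ)).congr_of_eventuallyEq
        (.of_forall fun y => h1 v y))
    · have hl := (((hρd (G.source d) y).hasDerivAt.mul (hρd (G.target d) y).hasDerivAt).sub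
        ((hηd d y).hasDerivAt.pow 2)).const_mul (a d.1)
      have := hl.unique ((hηd d y).hasDerivAt.congr_of_eventuallyEq (.of_forall fun y => h2 d y))
      refine Eq.trans ?_ this
      simp only [hρdef]
      norm_num
    · exact congrArg (fun f => deriv f y) (funext fun y => hs e y)
  set P : ℝ → ℂ := fun y => ∏ e, (1 + a e * η (e, true) y) with hP
  set Q : ℝ → ℂ := fun y => ∏ v, ρ v y with hQ
  have hP0 : ∀ y, P y ≠ 0 := fun y => Finset.prod_ne_zero_iff.2 fun e _ => (key y).1 e
  have hQ0 : ∀ y, Q y ≠ 0 := fun y => Finset.prod_ne_zero_iff.2 fun v _ => hρ0 v y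
  set Φ : ℝ → ℂ := fun y => P y / Q y with hΦ
  have hΦ0 : ∀ y, Φ y ≠ 0 := fun y => div_ne_zero (hP0 y) (hQ0 y)
  have hΦd : ∀ y, HasDerivAt Φ (Complex.I * (∑ v, ρ v y) * Φ y) y := by
    intro y
    have hPd : HasDerivAt P
        (P y * ∑ e, a e * deriv (η (e, true)) y / (1 + a e * η (e, true) y)) y :=
      HasDerivAt.finset_prod_logDeriv
        (fun e => ((hηd (e, true) y).hasDerivAt.const_mul (a e)).const_add 1) (key y).1
    have hQd : HasDerivAt Q (Q y * ∑ v, deriv (ρ v) y / ρ v y) y :=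
      HasDerivAt.finset_prod_logDeriv (fun v => (hρd v y).hasDerivAt) (fun v => hρ0 v y)
    refine (hPd.div hQd (hQ0 y)).congr_deriv ?_
    rw [← (key y).2]
    have := hQ0 y
    simp only [hΦ]
    field_simp
  set θ : ℝ → ℝ := fun y => ∑ v, phaseLine (μ v) t₀ y with hθ
  have hθd : ∀ y, HasDerivAt θ (∑ v, (ρ v y).re) y := fun y =>
    HasDerivAt.fun_sum fun v _ => hasDerivAt_phaseLine hδ (hμ v) y
  set K : ℝ → ℂ := fun y => Φ y / Φ (-y) * Complex.exp (-(2 * Complex.I * θ y)) with hK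
  have hKd : ∀ y, HasDerivAt K 0 y := by
    intro y
    have hneg : HasDerivAt (fun y => Φ (-y)) (-(Complex.I * (∑ v, ρ v (-y)) * Φ (-y))) y := by
      have := (hΦd (-y)).scomp y (hasDerivAt_neg y)
      simpa [Function.comp_def] using this
    have hexp : HasDerivAt (fun y : ℝ => Complex.exp (-(2 * Complex.I * θ y)))
        (Complex.exp (-(2 * Complex.I * θ y))
          * -(2 * Complex.I * ((∑ v, (ρ v y).re : ℝ) : ℂ))) y :=
      ((hθd y).ofReal_comp.const_mul (2 * Complex.I)).neg.cexp
    refine (((hΦd y).div hneg (hΦ0 (-y))).mul hexp).congr_deriv ?_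
    -- Only the real part of `∑ ρ` survives, as `ρ (-y)` is the conjugate of `ρ y`.
    have hre : (∑ v, ρ v y) + ∑ v, ρ v (-y) = 2 * ((∑ v, (ρ v y).re : ℝ) : ℂ) := by
      rw [← Finset.sum_add_distrib, Complex.ofReal_sum, Finset.mul_sum]
      refine Finset.sum_congr rfl fun v _ => ?_
      rw [hρdef]
      simp only
      rw [stieltjesLine_neg, Complex.add_conj]
      push_cast
      rfl
    have hm := hΦ0 (-y)
    generalize Complex.exp (-(2 * Complex.I * θ y)) = ε
    simp only [Pi.div_apply]
    field_simp
    linear_combination (Complex.I * Φ y * ε) * hre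
  have hK1 : ∀ y, K y = 1 := fun y => by
    rw [is_const_of_deriv_eq_zero (fun y => (hKd y).differentiableAt) (fun y => (hKd y).deriv) y 0]
    have : θ 0 = 0 := by simp [hθ, phaseLine_zero]
    simp only [hK, this]
    simp [div_self (hΦ0 0)]
  set N : ℝ := ∑ v, (μ v).real (Set.Iio t₀) with hN
  have hcob : (atTop : Filter ℝ) ≤ Bornology.cobounded ℝ := by
    rw [IsOrderBornology.cobounded_eq]; exact le_sup_right
  have hcob' : Tendsto (fun y : ℝ => -y) atTop (Bornology.cobounded ℝ) := by
    rw [IsOrderBornology.cobounded_eq]; exact tendsto_neg_atTop_atBot.mono_right le_sup_left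
  have hPlim : Tendsto P (Bornology.cobounded ℝ) (𝓝 1) := by
    have := tendsto_finsetProd (Finset.univ : Finset E) fun e _ =>
      ((hη (e, true)).const_mul (a e)).const_add 1
    simpa using this
  have hQlim : Tendsto (fun y : ℝ => (y * Complex.I) ^ Fintype.card V * Q y)
      (Bornology.cobounded ℝ) (𝓝 1) := by
    have := tendsto_finsetProd (Finset.univ : Finset V) fun v _ => hρ v
    simpa [Finset.prod_mul_distrib] using this
  have hΦlim : Tendsto (fun y => Φ y / Φ (-y)) atTop (𝓝 ((-1) ^ Fintype.card V)) := by
    have hl := ((((hPlim.mono_left hcob).div (hPlim.comp hcob') one_ne_zero).mul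
      ((hQlim.comp hcob').div (hQlim.mono_left hcob) one_ne_zero)).const_mul
        ((-1 : ℂ) ^ Fintype.card V))
    simp only [div_one, mul_one] at hl
    refine hl.congr' ?_
    filter_upwards [eventually_gt_atTop 0] with y hy
    have hy' : (y : ℂ) * Complex.I ≠ 0 := by simp [hy.ne']
    have e1 : ((-y : ℝ) : ℂ) * Complex.I = (-1) * (y * Complex.I) := by push_cast; ring
    simp only [hΦ, Pi.div_apply, Function.comp_apply]
    rw [e1, mul_pow]
    have q1 := hQ0 y
    have q2 := hQ0 (-y)
    have p2 := hP0 (-y)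
    have s1 : ((-1 : ℂ) ^ Fintype.card V) * (-1) ^ Fintype.card V = 1 := by
      rw [← mul_pow]; simp
    have hyp : ((y : ℂ) * Complex.I) ^ Fintype.card V ≠ 0 := pow_ne_zero _ hy'
    generalize ((y : ℂ) * Complex.I) ^ Fintype.card V = w at hyp
    generalize (-1 : ℂ) ^ Fintype.card V = s at s1
    field_simp
    linear_combination P y * s1
  have hθlim : Tendsto θ atTop (𝓝 (Real.pi / 2 * (2 * N - Fintype.card V))) := by
    have := tendsto_finsetSum (Finset.univ : Finset V) fun v _ =>
      tendsto_phaseLine hδ (hμ v) (hμ1 v)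
    rw [← Finset.mul_sum, Finset.sum_sub_distrib, ← Finset.mul_sum] at this
    simpa using this
  have hlim := hΦlim.mul ((Complex.continuous_exp.tendsto _).comp
    (((Complex.continuous_ofReal.tendsto _).comp hθlim).const_mul (2 * Complex.I)).neg)
  have hlim1 : Tendsto K atTop (𝓝 1) := by
    rw [funext hK1]
    exact tendsto_const_nhds
  have heq := tendsto_nhds_unique hlim1 hlim
  have hpow : (-1 : ℂ) ^ Fintype.card V
      = Complex.exp (-(Fintype.card V * (Real.pi * Complex.I))) := by
    rw [Complex.exp_neg, Complex.exp_nat_mul, Complex.exp_pi_mul_I, ← inv_pow]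
    norm_num
  rw [hpow, ← Complex.exp_add] at heq
  obtain ⟨n, hn⟩ := Complex.exp_eq_one_iff.1 heq.symm
  refine ⟨-n, ?_⟩
  have hpi : (2 * Real.pi * Complex.I : ℂ) ≠ 0 := Complex.two_pi_I_ne_zero
  have : (N : ℂ) = ((-n : ℤ) : ℂ) := by
    refine mul_right_cancel₀ hpi ?_
    push_cast at hn ⊢
    linear_combination -hn
  exact_mod_cast this

end Integrality

/-! ### Gaps of a compact set and zeros of Stieltjes transforms -/

section Gaps

theorem exists_isGap {K : Set ℝ} (hK : IsCompact K) {x y t : ℝ} (hx : x ∈ K) (hy : y ∈ K)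
    (hxt : x ≤ t) (hty : t ≤ y) (ht : t ∉ K) : ∃ α β, IsGap K α β ∧ t ∈ Set.Ioo α β := by
  obtain ⟨α, ⟨hα, hαt⟩, hα'⟩ := (hK.inter_right isClosed_Iic).exists_isGreatest ⟨x, hx, hxt⟩
  obtain ⟨β, ⟨hβ, hβt⟩, hβ'⟩ := (hK.inter_right isClosed_Ici).exists_isLeast ⟨y, hy, hty⟩
  have h1 : α < t := lt_of_le_of_ne hαt fun h => ht (h ▸ hα)
  have h2 : t < β := lt_of_le_of_ne hβt fun h => ht (h ▸ hβ)
  refine ⟨α, β, ⟨h1.trans h2, hα, hβ, Set.disjoint_left.2 fun s hs hsK => ?_⟩, h1, h2⟩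
  rcases le_total s t with h | h
  · exact not_lt.2 (hα' ⟨hsK, h⟩) hs.1
  · exact not_lt.2 (hβ' ⟨hsK, h⟩) hs.2

theorem exists_eq_Icc_of_no_gap {K : Set ℝ} (hK : IsCompact K) (hne : K.Nonempty)
    (h : ∀ α β, ¬ IsGap K α β) : ∃ c d, c ≤ d ∧ K = Set.Icc c d := by
  obtain ⟨c, hc, hc'⟩ := hK.exists_isLeast hne
  obtain ⟨d, hd, hd'⟩ := hK.exists_isGreatest hne
  refine ⟨c, d, hc' hd, Set.Subset.antisymm (fun t ht => ⟨hc' ht, hd' ht⟩) fun t ht => ?_⟩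
  by_contra htK
  obtain ⟨α, β, hg, -⟩ := exists_isGap hK hc hd ht.1 ht.2 htK
  exact h α β hg

theorem exists_iUnion_Icc_of_encard_gaps_le (n : ℕ) : ∀ {K : Set ℝ}, IsCompact K → K.Nonempty →
    {q : ℝ × ℝ | IsGap K q.1 q.2}.encard ≤ n →
    ∃ S : Finset (ℝ × ℝ), S.card ≤ n + 1 ∧ (∀ q ∈ S, q.1 ≤ q.2) ∧
      K = ⋃ q ∈ S, Set.Icc q.1 q.2 := by
  classical
  induction n with
  | zero =>
    intro K hK hne h
    have h0 : {q : ℝ × ℝ | IsGap K q.1 q.2} = ∅ := by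
      rw [← Set.encard_eq_zero]; simpa using h
    obtain ⟨c, d, hcd, hKe⟩ := exists_eq_Icc_of_no_gap hK hne fun α β hg =>
      (Set.eq_empty_iff_forall_notMem.1 h0 (α, β)) hg
    exact ⟨{(c, d)}, by simp, by simpa using hcd, by simpa using hKe⟩
  | succ n ih =>
    intro K hK hne h
    by_cases hg : ∀ α β, ¬ IsGap K α β
    · obtain ⟨c, d, hcd, hKe⟩ := exists_eq_Icc_of_no_gap hK hne hg
      exact ⟨{(c, d)}, by simp, by simpa using hcd, by simpa using hKe⟩
    push Not at hg
    obtain ⟨α₀, β₀, hg₀⟩ := hg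
    have hfin : {q : ℝ × ℝ | IsGap K q.1 q.2}.Finite :=
      Set.finite_of_encard_le_coe h
    -- The leftmost gap, to the left of which there is a single interval.
    obtain ⟨⟨α, β⟩, hq, hmin⟩ := hfin.exists_minimalFor (fun q : ℝ × ℝ => q.1) _ ⟨(α₀, β₀), hg₀⟩
    have hq' : IsGap K α β := hq
    obtain ⟨hαβ, hα, hβ, hdisj⟩ := hq'
    have hsplit : K = (K ∩ Set.Iic α) ∪ (K ∩ Set.Ici β) := by
      rw [← Set.inter_union_distrib_left]
      refine (Set.inter_eq_left.2 fun t ht => ?_).symm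
      by_contra hcon
      simp only [Set.mem_union, Set.mem_Iic, Set.mem_Ici, not_or, not_le] at hcon
      exact Set.disjoint_left.1 hdisj hcon ht
    have hno : ∀ α' β', ¬ IsGap (K ∩ Set.Iic α) α' β' := by
      rintro α' β' ⟨h1, h2, h3, h4⟩
      have hgap : IsGap K α' β' := ⟨h1, h2.1, h3.1, Set.disjoint_left.2 fun s hs hsK =>
        Set.disjoint_left.1 h4 hs ⟨hsK, hs.2.le.trans h3.2⟩⟩
      have h5 : α' < α := h1.trans_le h3.2
      exact not_le.2 h5 (hmin (j := (α', β')) hgap h5.le)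
    obtain ⟨c, d, hcd, hKe⟩ := exists_eq_Icc_of_no_gap (hK.inter_right isClosed_Iic)
      ⟨α, hα, Set.self_mem_Iic⟩ hno
    have hsub : {q : ℝ × ℝ | IsGap (K ∩ Set.Ici β) q.1 q.2}
        ⊆ {q : ℝ × ℝ | IsGap K q.1 q.2} \ {(α, β)} := by
      rintro ⟨α', β'⟩ ⟨h1, h2, h3, h4⟩
      refine ⟨⟨h1, h2.1, h3.1, Set.disjoint_left.2 fun s hs hsK =>
        Set.disjoint_left.1 h4 hs ⟨hsK, (Set.mem_Ici.1 h2.2).trans hs.1.le⟩⟩, fun heq => ?_⟩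
      have h5 : α' = α := congrArg Prod.fst heq
      have h6 : β ≤ α' := h2.2
      linarith
    have hcard : {q : ℝ × ℝ | IsGap (K ∩ Set.Ici β) q.1 q.2}.encard ≤ n := by
      refine (Set.encard_le_encard hsub).trans ?_
      have h1 := Set.encard_sdiff_singleton_add_one (s := {q : ℝ × ℝ | IsGap K q.1 q.2})
        (a := (α, β)) hq
      rw [← h1] at h
      push_cast at h
      exact (ENat.add_le_add_iff_right ENat.one_ne_top).1 h
    obtain ⟨S, hS1, hS2, hS3⟩ := ih (hK.inter_right isClosed_Ici) ⟨β, hβ, Set.self_mem_Ici⟩ hcard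
    refine ⟨insert (c, d) S, (Finset.card_insert_le _ _).trans (by omega), ?_, ?_⟩
    · intro q hq
      rcases Finset.mem_insert.1 hq with rfl | hq
      · exact hcd
      · exact hS2 q hq
    · rw [Finset.set_biUnion_insert, ← hS3]
      exact hsplit.trans (by rw [hKe])

/-- A label that increases across every point of the set takes different values on different gaps,
so there are at most `p - 1` gaps if the label of each gap lies in `{1, …, p - 1}`. -/
theorem exists_iUnion_Icc_of_gap_labels {K : Set ℝ} (hK : IsCompact K) {p : ℕ} (hp : 0 < p)
    (k : ℝ → ℝ) (hgap : ∀ α β, IsGap K α β → ∃ j : ℕ, 1 ≤ j ∧ j < p ∧ ∀ t ∈ Set.Ioo α β, k t = j)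
    (hmono : ∀ s t t', s ∈ K → t < s → s < t' → k t < k t') :
    ∃ n : ℕ, n ≤ p ∧ ∃ c d : Fin n → ℝ, (∀ i, c i ≤ d i) ∧ K = ⋃ i, Set.Icc (c i) (d i) := by
  classical
  rcases K.eq_empty_or_nonempty with rfl | hne
  · exact ⟨0, hp.le, fun _ => 0, fun _ => 0, fun _ => le_rfl, by simp⟩
  have hcard : {q : ℝ × ℝ | IsGap K q.1 q.2}.encard ≤ (p - 1 : ℕ) := by
    have h : ∀ q : ℝ × ℝ, ∃ j : ℕ, IsGap K q.1 q.2 →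
        (1 ≤ j ∧ j < p ∧ ∀ t ∈ Set.Ioo q.1 q.2, k t = j) := fun q => by
      by_cases hq : IsGap K q.1 q.2
      · obtain ⟨j, hj⟩ := hgap _ _ hq
        exact ⟨j, fun _ => hj⟩
      · exact ⟨0, fun h => absurd h hq⟩
    choose f hf using h
    have hlt : ∀ q q' : ℝ × ℝ, IsGap K q.1 q.2 → IsGap K q'.1 q'.2 → f q = f q' → q'.1 < q.2 := by
      intro q q' hq hq' he
      by_contra! hle
      obtain ⟨t, ht⟩ := Set.nonempty_Ioo.2 hq.1
      obtain ⟨t', ht'⟩ := Set.nonempty_Ioo.2 hq'.1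
      have h1 := hmono q.2 t t' hq.2.2.1 ht.2 (hle.trans_lt ht'.1)
      rw [(hf q hq).2.2 t ht, (hf q' hq').2.2 t' ht', he] at h1
      exact lt_irrefl _ h1
    have hinj : Set.InjOn f {q : ℝ × ℝ | IsGap K q.1 q.2} := by
      intro q hq q' hq' he
      have h1 := hlt q q' hq hq' he
      have h2 := hlt q' q hq' hq he.symm
      obtain ⟨hq1, hqa, hqb, hqd⟩ := hq
      obtain ⟨hq1', hqa', hqb', hqd'⟩ := hq'
      have ha : q.1 = q'.1 := by
        rcases lt_trichotomy q.1 q'.1 with h | h | h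
        · exact absurd hqa' (Set.disjoint_left.1 hqd ⟨h, h1⟩)
        · exact h
        · exact absurd hqa (Set.disjoint_left.1 hqd' ⟨h, h2⟩)
      have hb : q.2 = q'.2 := by
        rcases lt_trichotomy q.2 q'.2 with h | h | h
        · exact absurd hqb (Set.disjoint_left.1 hqd' ⟨h1, h⟩)
        · exact h
        · exact absurd hqb' (Set.disjoint_left.1 hqd ⟨h2, h⟩)
      exact Prod.ext ha hb
    have hmaps : Set.MapsTo f {q : ℝ × ℝ | IsGap K q.1 q.2} (Finset.Ico 1 p : Finset ℕ) :=
      fun q hq => by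
        have := hf q hq
        simp [this.1, this.2.1]
    refine (Set.encard_le_encard_of_injOn hmaps hinj).trans ?_
    rw [Set.encard_coe_eq_coe_finsetCard]
    simp
  obtain ⟨S, hS1, hS2, hS3⟩ := exists_iUnion_Icc_of_encard_gaps_le (p - 1) hK hne hcard
  refine ⟨S.card, by omega, fun i => (S.equivFin.symm i).1.1, fun i => (S.equivFin.symm i).1.2,
    fun i => hS2 _ (S.equivFin.symm i).2, ?_⟩
  rw [hS3, S.equivFin.symm.surjective.iUnion_comp
    (fun q : S => Set.Icc (q : ℝ × ℝ).1 (q : ℝ × ℝ).2), Set.iUnion_subtype]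

end Gaps

section GreenInGap

open MeasureTheory

variable {μ : Measure ℝ} [IsFiniteMeasure μ] {α β : ℝ}

theorem exists_pos_le_abs_sub_of_notMem {K : Set ℝ} (hK : IsClosed K) {t : ℝ} (ht : t ∉ K) :
    ∃ δ, 0 < δ ∧ ∀ s ∈ K, δ ≤ |t - s| := by
  obtain ⟨δ, hδ, h⟩ := Metric.isOpen_iff.1 hK.isOpen_compl t ht
  refine ⟨δ, hδ, fun s hs => ?_⟩
  by_contra! hlt
  exact h (by rwa [Metric.mem_ball, dist_comm, Real.dist_eq]) hs

/-- In an interval without mass the Stieltjes transform is strictly decreasing, so it takes no value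
twice. -/
theorem stieltjesLine_zero_ne (h1 : μ.real Set.univ = 1) {K : Set ℝ} (hK : IsClosed K)
    (hμ : ∀ᵐ s ∂μ, s ∈ K) (hd : Disjoint (Set.Ioo α β) K) {t t' : ℝ} (ht : t ∈ Set.Ioo α β)
    (ht' : t' ∈ Set.Ioo α β) (htt : t < t') : stieltjesLine μ t 0 ≠ stieltjesLine μ t' 0 := by
  intro heq
  have hi : ∀ x ∈ Set.Ioo α β, Integrable (fun s : ℝ => (x - s) / ((x - s) ^ 2 + 0 ^ 2)) μ ∧
      (stieltjesLine μ x 0).re = ∫ s, (x - s) / ((x - s) ^ 2 + 0 ^ 2) ∂μ := by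
    intro x hx
    obtain ⟨δ, hδ, h⟩ := exists_pos_le_abs_sub_of_notMem hK (Set.disjoint_left.1 hd hx)
    have hae : ∀ᵐ s ∂μ, δ ≤ |x - s| := hμ.mono h
    have h2 := (integrable_inv_line_sub hδ hae 0).re
    simp only [RCLike.re_eq_complex_re, re_inv_line_sub] at h2
    exact ⟨h2, re_stieltjesLine hδ hae 0⟩
  have hpos : ∀ᵐ s ∂μ, 0 < (t - s) / ((t - s) ^ 2 + 0 ^ 2) - (t' - s) / ((t' - s) ^ 2 + 0 ^ 2) := by
    filter_upwards [hμ] with s hs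
    have hs' : s ∉ Set.Ioo α β := fun h => Set.disjoint_left.1 hd h hs
    have hprod : 0 < (t - s) * (t' - s) := by
      by_cases hsα : s ≤ α
      · exact mul_pos (by linarith [ht.1]) (by linarith [ht'.1])
      · have : β ≤ s := by
          by_contra! h
          exact hs' ⟨not_le.1 hsα, h⟩
        exact mul_pos_of_neg_of_neg (by linarith [ht.2]) (by linarith [ht'.2])
    have e1 : t - s ≠ 0 := left_ne_zero_of_mul hprod.ne'
    have e2 : t' - s ≠ 0 := right_ne_zero_of_mul hprod.ne'
    have : (t - s) / ((t - s) ^ 2 + 0 ^ 2) - (t' - s) / ((t' - s) ^ 2 + 0 ^ 2)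
        = (t' - t) / ((t - s) * (t' - s)) := by
      rw [zero_pow two_ne_zero, add_zero, add_zero]
      field_simp
      ring
    rw [this]
    exact div_pos (by linarith) hprod
  have h0 : ∫ s, ((t - s) / ((t - s) ^ 2 + 0 ^ 2) - (t' - s) / ((t' - s) ^ 2 + 0 ^ 2)) ∂μ = 0 := by
    rw [integral_sub (hi t ht).1 (hi t' ht').1, ← (hi t ht).2, ← (hi t' ht').2, heq, sub_self]
  rw [integral_eq_zero_iff_of_nonneg_ae (hpos.mono fun _ h => h.le)
    ((hi t ht).1.sub (hi t' ht').1)] at h0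
  have hμ0 : μ = 0 := by
    rw [← ae_eq_bot, ← Filter.empty_mem_iff_bot]
    filter_upwards [h0, hpos] with s hs hs'
    exact hs'.ne' hs
  simp [hμ0] at h1

/-- Somewhere in a gap, finitely many Stieltjes transforms are all non-zero, as each of them has at
most one zero there. -/
theorem exists_stieltjesLine_ne_zero {V : Type*} [Finite V] {μ : V → Measure ℝ}
    [∀ v, IsFiniteMeasure (μ v)] (h1 : ∀ v, (μ v).real Set.univ = 1) {K : Set ℝ}
    (hK : IsClosed K) (hμ : ∀ v, ∀ᵐ s ∂μ v, s ∈ K) (hαβ : α < β) (hd : Disjoint (Set.Ioo α β) K) :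
    ∃ t ∈ Set.Ioo α β, ∀ v, stieltjesLine (μ v) t 0 ≠ 0 := by
  have hfin : (⋃ v, {t | t ∈ Set.Ioo α β ∧ stieltjesLine (μ v) t 0 = 0}).Finite := by
    refine Set.finite_iUnion fun v => Set.Subsingleton.finite fun t ht t' ht' => ?_
    by_contra hne
    rcases lt_or_gt_of_ne hne with h | h
    · exact stieltjesLine_zero_ne (h1 v) hK (hμ v) hd ht.1 ht'.1 h (ht.2.trans ht'.2.symm)
    · exact stieltjesLine_zero_ne (h1 v) hK (hμ v) hd ht'.1 ht.1 h (ht'.2.trans ht.2.symm)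
  obtain ⟨t, ht, ht'⟩ := ((Set.Ioo_infinite hαβ).sdiff hfin).nonempty
  refine ⟨t, ht, fun v h0 => ht' ?_⟩
  exact Set.mem_iUnion.2 ⟨v, ht, h0⟩

end GreenInGap

/-! ### Gap labels of the periodic Jacobi matrix -/

namespace GraphCovering

open MeasureTheory Filter Topology

variable {V E W : Type*} {T : SimpleGraph W} {G : Multigraph V E} [Fintype V] [Fintype E]
  [T.LocallyFinite] [DecidableEq W]

theorem spectralMeasure_jacobi_deck {Ξ : GraphCovering T G} (b : V → ℝ) (a : E → ℝ) {φ : W ≃ W}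
    (hφ : Ξ.IsDeckMap φ) (hφ' : Ξ.IsDeckMap φ.symm) (x : W) :
    spectralMeasure (Ξ.jacobi b a) (lp.single 2 (φ x) (1 : ℂ))
      = spectralMeasure (Ξ.jacobi b a) (lp.single 2 x (1 : ℂ)) := by
  rw [← permuteVertexSpace_single]
  exact spectralMeasure_map_isometry _ (jacobi_commute b a hφ hφ') _

theorem spectralMeasure_jacobi_real_univ (Ξ : GraphCovering T G) (b : V → ℝ) (a : E → ℝ) (x : W) :
    (spectralMeasure (Ξ.jacobi b a) (lp.single 2 x (1 : ℂ))).real Set.univ = 1 := by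
  rw [spectralMeasure_real_univ (Ξ.isSelfAdjoint_jacobi b a), lp.norm_single (by norm_num)]
  simp

/-- The diagonal Green's function on a vertical line is the Stieltjes transform of the spectral
measure. -/
theorem matrixElement_resolvent_eq (Ξ : GraphCovering T G) (b : V → ℝ) (a : E → ℝ) {t₀ : ℝ}
    (ht₀ : t₀ ∉ spectrum ℝ (Ξ.jacobi b a)) (x : W) (y : ℝ) :
    matrixElement x x (resolvent (Ξ.jacobi b a) (t₀ + y * Complex.I))
      = stieltjesLine (spectralMeasure (Ξ.jacobi b a) (lp.single 2 x (1 : ℂ))) t₀ y := by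
  rw [matrixElement_eq_inner, inner_resolvent (Ξ.isSelfAdjoint_jacobi b a) _ (Or.inr (by simpa))]
  rfl

/-- Every open set that meets the spectrum has mass for one of the spectral measures at the chosen
vertices, because every vertex is a translate of a chosen one. -/
theorem sum_spectralMeasure_real_pos (Ξ : GraphCovering T G) (hT : T.IsTree) (b : V → ℝ)
    (a : E → ℝ) {r : V → W} (hr : ∀ j, Ξ.onVert (r j) = j) {O : Set ℝ} (hO : IsOpen O) {s : ℝ}
    (hs : s ∈ spectrum ℝ (Ξ.jacobi b a)) (hsO : s ∈ O) :
    0 < ∑ v, (spectralMeasure (Ξ.jacobi b a) (lp.single 2 (r v) (1 : ℂ))).real O := by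
  refine (Finset.sum_nonneg fun _ _ => measureReal_nonneg).lt_of_ne' fun h0 => ?_
  refine notMem_spectrum_of_spectralMeasure_eq_zero (Ξ.isSelfAdjoint_jacobi b a)
    (fun x : W => (lp.single 2 x (1 : ℂ) : VertexSpace W)) (fun A hA => eq_zero_of_apply_single hA)
    hO (fun x => ?_) hsO hs
  have h1 := (Finset.sum_eq_zero_iff_of_nonneg fun _ _ => measureReal_nonneg).1 h0
    (Ξ.onVert x) (Finset.mem_univ _)
  obtain ⟨φ, hφ, hφ', hx⟩ := Ξ.exists_deck_equiv hT (x := r (Ξ.onVert x)) (x' := x) (hr _).symm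
  rw [← spectralMeasure_jacobi_deck b a hφ hφ', hx] at h1
  exact (measureReal_eq_zero_iff).1 h1

/-- The number of states per period to the left of a point off the spectrum is an integer, provided
that no diagonal element of the Green's function vanishes at this point. -/
theorem exists_int_sum_spectralMeasure (Ξ : GraphCovering T G) (hT : T.IsTree) (b : V → ℝ)
    {a : E → ℝ} (ha : ∀ e, 0 < a e) {r : V → W} (hr : ∀ j, Ξ.onVert (r j) = j) {t₀ : ℝ}
    (ht₀ : t₀ ∉ spectrum ℝ (Ξ.jacobi b a))
    (h0 : ∀ v,
      stieltjesLine (spectralMeasure (Ξ.jacobi b a) (lp.single 2 (r v) (1 : ℂ))) t₀ 0 ≠ 0) :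
    ∃ N : ℤ, ∑ v, (spectralMeasure (Ξ.jacobi b a) (lp.single 2 (r v) (1 : ℂ))).real (Set.Iio t₀)
      = N := by
  classical
  set H := Ξ.jacobi b a with hH
  set μ : V → Measure ℝ := fun v => spectralMeasure H (lp.single 2 (r v) (1 : ℂ)) with hμ
  set z : ℝ → ℂ := fun y => t₀ + y * Complex.I with hz
  have hsa : IsSelfAdjoint H := Ξ.isSelfAdjoint_jacobi b a
  have hzr : ∀ y, z y ∈ resolventSet ℂ H := fun y =>
    (resolvent_eq_cfc hsa (Or.inr (by simpa [hz]))).1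
  obtain ⟨δ, hδ, hδ'⟩ := exists_pos_le_abs_sub_of_notMem (spectrum.isClosed H) ht₀
  have hμδ : ∀ v, ∀ᵐ t ∂μ v, δ ≤ |t₀ - t| := fun v => (ae_mem_spectrum H _).mono hδ'
  have hμ1 : ∀ v, (μ v).real Set.univ = 1 := fun v => Ξ.spectralMeasure_jacobi_real_univ b a _
  have hρ : ∀ v y, matrixElement (r v) (r v) (resolvent H (z y)) = stieltjesLine (μ v) t₀ y :=
    fun v y => Ξ.matrixElement_resolvent_eq b a ht₀ (r v) y
  have hρ0 : ∀ v y, stieltjesLine (μ v) t₀ y ≠ 0 := fun v y => by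
    by_cases hy : y = 0
    · rw [hy]
      exact h0 v
    · exact stieltjesLine_ne_zero hδ (hμδ v) (hμ1 v) hy
  -- The diagonal elements at all vertices, by invariance under deck transformations.
  have hdiag : ∀ x y, matrixElement x x (resolvent H (z y))
      = stieltjesLine (μ (Ξ.onVert x)) t₀ y := by
    intro x y
    obtain ⟨φ, hφ, hφ', hx⟩ := Ξ.exists_deck_equiv hT (x := r (Ξ.onVert x)) (x' := x) (hr _).symm
    rw [← hρ, ← matrixElement_deck b a hφ hφ' (z y) (r (Ξ.onVert x)), hx]
  have hd : ∀ (x w : W) y,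
      DifferentiableAt ℝ (fun y => matrixElement x w (resolvent H (z y))) y := by
    intro x w y
    have h1 : HasDerivAt z Complex.I y := by
      have := ((hasDerivAt_id y).ofReal_comp.mul_const Complex.I).const_add (t₀ : ℂ)
      simpa [hz] using this
    have h2 := (spectrum.hasDerivAt_resolvent_const_left (hzr y)).scomp y h1
    have h3 := ((matrixElement x w).restrictScalars ℝ).hasFDerivAt.comp_hasDerivAt y h2
    exact h3.differentiableAt
  have hadj : ∀ d : E × Bool, ∃ h : T.Adj (r (G.source d)) (Ξ.liftEnd (r (G.source d)) d),
      Ξ.onDart ⟨(r (G.source d), Ξ.liftEnd (r (G.source d)) d), h⟩ = d :=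
    fun d => Ξ.adj_liftEnd (hr _).symm
  have hent : ∀ d : E × Bool, Ξ.entry b a (r (G.source d)) (Ξ.liftEnd (r (G.source d)) d) = a d.1 :=
    fun d => by
      obtain ⟨h, e⟩ := hadj d
      rw [entry_of_adj Ξ b a h, e]
  have hend : ∀ d : E × Bool, Ξ.onVert (Ξ.liftEnd (r (G.source d)) d) = G.target d := fun d => by
    obtain ⟨h, e⟩ := hadj d
    exact (Ξ.onVert_snd ⟨(_, _), h⟩).trans (congrArg G.target e)
  set η : E × Bool → ℝ → ℂ := fun d y =>
    matrixElement (Ξ.liftEnd (r (G.source d)) d) (r (G.source d)) (resolvent H (z y)) with hη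
  have hcob : Tendsto z (Bornology.cobounded ℝ) (Bornology.cobounded ℂ) := by
    rw [← tendsto_norm_atTop_iff_cobounded]
    refine tendsto_atTop_mono (fun y => ?_) tendsto_norm_cobounded_atTop
    have := Complex.abs_im_le_norm (z y)
    simpa [hz] using this
  have hR : Tendsto (fun y => resolvent H (z y)) (Bornology.cobounded ℝ) (𝓝 0) :=
    (spectrum.resolvent_tendsto_cobounded H).comp hcob
  refine exists_int_sum_measureReal_Iio G (a := fun e => (a e : ℂ))
    (fun e => by exact_mod_cast (ha e).ne') (fun v => (b v : ℂ)) hμ1 hδ hμδ (η := η) h0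
    (fun v y => ?_) (fun d y => hd _ _ y) (fun v y => ?_) (fun d y => ?_) (fun e y => ?_)
    (fun d => ?_) (fun v => ?_)
  · have : stieltjesLine (μ v) t₀ = fun y => matrixElement (r v) (r v) (resolvent H (z y)) :=
      funext fun y => (hρ v y).symm
    rw [this]
    exact hd _ _ y
  · have h := Ξ.matrixElement_row b a (hzr y) (r v)
    rw [hr, ← hH, hρ] at h
    rw [← h]
    congr 1
    refine Finset.sum_congr rfl fun d hd => ?_
    rw [hη, ← (Finset.mem_filter.1 hd).2]
  · obtain ⟨h, -⟩ := hadj d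
    have h2 := Ξ.matrixElement_edge b a hT.isAcyclic (hzr y) h.symm
    rw [entry_comm, hent, ← hH, hdiag, hdiag, hend, hr] at h2
    rw [mul_comm (stieltjesLine _ _ _)]
    exact h2
  · -- A deck transformation carries the lift of an edge in one direction to the lift in the other.
    set d : E × Bool := (e, true)
    obtain ⟨h, he⟩ := hadj d
    obtain ⟨h', he'⟩ := hadj (G.reverse d)
    set x := r (G.source d)
    set w := Ξ.liftEnd x d
    set x' := r (G.source (G.reverse d))
    set w' := Ξ.liftEnd x' (G.reverse d)
    obtain ⟨φ, hφ, hφ', hx⟩ := Ξ.exists_deck_equiv hT (x := w) (x' := x')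
      ((hr _).trans (hend d).symm)
    have hw : φ x = w' := by
      obtain ⟨h1, e1⟩ := hφ.onDart h.symm
      have e2 : Ξ.onDart ⟨(w, x), h.symm⟩ = G.reverse d :=
        (Ξ.onDart_symm ⟨(x, w), h⟩).trans (congrArg G.reverse he)
      have h3 : T.Adj x' (φ x) := hx ▸ h1
      refine Ξ.eq_of_onDart_eq h3 h' ?_
      rw [he', ← e2, ← e1]
      congr 3
      exact hx.symm
    have e3 := matrixElement_deck b a hφ hφ' (z y) x w
    rw [hx, hw] at e3
    have e4 := Ξ.matrixElement_comm b a hT.isAcyclic (hzr y) h (by rw [hent]; exact (ha _).ne')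
      (by rw [← hH, hdiag]; exact hρ0 _ y)
    exact e3.trans e4.symm
  · have := ((matrixElement (Ξ.liftEnd (r (G.source d)) d) (r (G.source d))).continuous.tendsto
      0).comp hR
    rwa [map_zero] at this
  · have h1 : ∀ y : ℝ, y * Complex.I * stieltjesLine (μ v) t₀ y
        = 1 + matrixElement (r v) (r v) (H * resolvent H (z y))
          - t₀ * matrixElement (r v) (r v) (resolvent H (z y)) := by
      intro y
      have e1 := congrArg (matrixElement (r v) (r v)) (mul_resolvent_cancel (hzr y))
      rw [sub_mul, map_sub, Algebra.algebraMap_eq_smul_one, smul_mul_assoc, one_mul, map_smul,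
        hρ, matrixElement_apply _ _ (1 : VertexSpace W →L[ℂ] VertexSpace W),
        one_apply_eq_self, lp.single_apply_self, smul_eq_mul] at e1
      rw [hρ]
      simp only [hz] at e1 ⊢
      linear_combination e1
    have h2 : Tendsto (fun y => H * resolvent H (z y)) (Bornology.cobounded ℝ) (𝓝 0) := by
      simpa using hR.const_mul H
    have h3 := ((matrixElement (r v) (r v)).continuous.tendsto 0).comp h2
    have h4 := ((matrixElement (r v) (r v)).continuous.tendsto 0).comp hR
    rw [map_zero] at h3 h4
    have h5 := (h3.const_add 1).sub (h4.const_mul (t₀ : ℂ))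
    rw [funext h1]
    simpa using h5

end GraphCovering

section IntegratedDensity

open MeasureTheory

theorem integratedDensityOfStates_eq {V W : Type*} [Fintype V] [DecidableEq W]
    (H : VertexSpace W →L[ℂ] VertexSpace W) (r : V → W) (t : ℝ) :
    integratedDensityOfStates H r t
      = (∑ v, (spectralMeasure H (lp.single 2 (r v) (1 : ℂ))).real (Set.Iio t))
        / Fintype.card V := by
  rw [integratedDensityOfStates, densityOfStates, measureReal_ennreal_smul_apply,
    measureReal_def, Measure.finsetSum_apply,
    ENNReal.toReal_sum fun _ _ => measure_ne_top _ _]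
  simp [measureReal_def, div_eq_inv_mul]

end IntegratedDensity
end

theorem theorem5p1 {V E W : Type*} [Fintype V] [Fintype E] [DecidableEq W]
    (G : Multigraph V E) (hconn : G.Connected) (hleaf : ∀ v : V, 2 ≤ G.degree v)
    (b : V → ℝ) (a : E → ℝ) (ha : ∀ e : E, 0 < a e)
    (T : SimpleGraph W) [T.LocallyFinite] (hT : T.IsTree) (Ξ : GraphCovering T G)
    (r : V → W) (hr : ∀ j : V, Ξ.onVert (r j) = j) :
    (∀ α β : ℝ, IsGap (spectrum ℝ (Ξ.jacobi b a)) α β →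
      ∃ j : ℕ, 1 ≤ j ∧ j < Fintype.card V ∧
        ∀ t ∈ Set.Ioo α β,
          integratedDensityOfStates (Ξ.jacobi b a) r t = (j : ℝ) / (Fintype.card V : ℝ)) ∧
    ∃ n : ℕ, n ≤ Fintype.card V ∧ ∃ c d : Fin n → ℝ,
      (∀ i, c i ≤ d i) ∧ spectrum ℝ (Ξ.jacobi b a) = ⋃ i, Set.Icc (c i) (d i) := by
  have hV : Nonempty V := hconn.1
  have hp : 0 < Fintype.card V := Fintype.card_pos
  set H := Ξ.jacobi b a with hH
  set μ : V → MeasureTheory.Measure ℝ := fun v => spectralMeasure H (lp.single 2 (r v) (1 : ℂ))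
    with hμ
  set N : ℝ → ℝ := fun t => ∑ v, (μ v).real (Set.Iio t) with hN
  have hμ1 : ∀ v, (μ v).real Set.univ = 1 := fun v => Ξ.spectralMeasure_jacobi_real_univ b a _
  have hpos : ∀ {O : Set ℝ}, IsOpen O → ∀ {s}, s ∈ spectrum ℝ H → s ∈ O →
      0 < ∑ v, (μ v).real O := fun hO _ hs hsO => Ξ.sum_spectralMeasure_real_pos hT b a hr hO hs hsO
  have hmono : ∀ s t t', s ∈ spectrum ℝ H → t < s → s < t' → N t < N t' := by
    intro s t t' hs hts hst
    have h1 : ∀ v, (μ v).real (Set.Iio t) + (μ v).real (Set.Ioo t t')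
        ≤ (μ v).real (Set.Iio t') := by
      intro v
      rw [← MeasureTheory.measureReal_union (Set.disjoint_left.2 fun x hx hx' => by
        exact lt_asymm hx hx'.1) measurableSet_Ioo]
      refine MeasureTheory.measureReal_mono (Set.union_subset (fun x hx => ?_) fun x hx => hx.2)
      exact lt_trans hx (hts.trans hst)
    have h2 := Finset.sum_le_sum fun v (_ : v ∈ Finset.univ) => h1 v
    rw [Finset.sum_add_distrib] at h2
    linarith [hpos isOpen_Ioo hs ⟨hts, hst⟩]
  have hlabel : ∀ α β, IsGap (spectrum ℝ H) α β → ∃ j : ℕ, 1 ≤ j ∧ j < Fintype.card V ∧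
      ∀ t ∈ Set.Ioo α β, N t = j := by
    rintro α β ⟨hαβ, hα, hβ, hd⟩
    have hconst : ∀ t ∈ Set.Ioo α β, ∀ t' ∈ Set.Ioo α β, N t = N t' := by
      intro t ht t' ht'
      refine Finset.sum_congr rfl fun v _ => MeasureTheory.measureReal_congr ?_
      filter_upwards [ae_mem_spectrum H (lp.single 2 (r v) (1 : ℂ))] with s hs
      have hs' : s ∉ Set.Ioo α β := fun h => Set.disjoint_left.1 hd h hs
      refine propext ⟨fun h => ?_, fun h => ?_⟩
      · by_contra hc
        exact hs' ⟨ht'.1.trans_le (not_lt.1 hc), (lt_trans h ht.2 : s < β)⟩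
      · by_contra hc
        exact hs' ⟨ht.1.trans_le (not_lt.1 hc), (lt_trans h ht'.2 : s < β)⟩
    obtain ⟨t₀, ht₀, hne⟩ := exists_stieltjesLine_ne_zero hμ1 (spectrum.isClosed H)
      (fun v => ae_mem_spectrum H _) hαβ hd
    obtain ⟨n, hn⟩ := Ξ.exists_int_sum_spectralMeasure hT b ha hr
      (Set.disjoint_left.1 hd ht₀) hne
    have hn' : N t₀ = n := hn
    have h1 : 0 < N t₀ := hpos isOpen_Iio hα ht₀.1
    have h2 : N t₀ < Fintype.card V := by
      have h3 : ∀ v, (μ v).real (Set.Iio t₀) + (μ v).real (Set.Ioi t₀) ≤ 1 := fun v => by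
        rw [← MeasureTheory.measureReal_union (Set.disjoint_left.2 fun x hx hx' => by
          exact lt_asymm (Set.mem_Iio.1 hx) (Set.mem_Ioi.1 hx')) measurableSet_Ioi, ← hμ1 v]
        exact MeasureTheory.measureReal_mono (Set.subset_univ _)
      have h4 := Finset.sum_le_sum fun v (_ : v ∈ Finset.univ) => h3 v
      rw [Finset.sum_add_distrib, Finset.sum_const, Finset.card_univ, nsmul_one] at h4
      linarith [hpos isOpen_Ioi hβ ht₀.2]
    rw [hn'] at h1 h2
    have h1' : 0 < n := by exact_mod_cast h1
    have h2' : n < Fintype.card V := by exact_mod_cast h2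
    lift n to ℕ using h1'.le
    refine ⟨n, by omega, by omega, fun t ht => ?_⟩
    rw [hconst t ht t₀ ht₀, hn']
    simp
  refine ⟨fun α β hg => ?_,
    exists_iUnion_Icc_of_gap_labels (spectrum.isCompact H) hp N hlabel hmono⟩
  obtain ⟨j, hj1, hj2, hj⟩ := hlabel α β hg
  refine ⟨j, hj1, hj2, fun t ht => ?_⟩
  rw [integratedDensityOfStates_eq, ← hj t ht]
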